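/- Let $M$ be a finite loopless matroid of rank $r$ on a ground set $E=\{e_1,\dots,e_n\}$, with rank function $r(\cdot)$, and suppose that $M$ is uniformly dense, i.e. $|X|/r(X)\le |E|/r(E)$ for every nonempty $X\subseteq E$. Random assignment model: an adversary chooses weights $w_1\ge\dots\ge w_n\ge 0$; a uniformly random permutation $\sigma$ of $\{1,\dots,n\}$ gives element $e_{\sigma(i)}$ the weight $w_i$; the elements then arrive in the order $e_{\pi(1)},\dots,e_{\pi(n)}$, where $\pi$ is a uniformly random permutation independent of $\sigma$. An online algorithm must irrevocably accept or reject each element on its arrival, keeping the accepted set independent in $M$, and may use only its own randomness, the identities of the elements seen so far and the relative order of their weights. Let $\mathrm{OPT}(\sigma)$ be the base of $M$ selected by the greedy procedure on $e_{\sigma(1)},\dots,e_{\sigma(n)}$ (each element is selected if it keeps the selection independent), and write $w(S)$ for the total weight of the elements of $S$. An online algorithm with output $\mathrm{ALG}$ is $c$-competitive if $c\,\mathbb E[w(\mathrm{ALG})]\ge\mathbb E_\sigma[w(\mathrm{OPT}(\sigma))]$ for every choice of the weights by the adversary. Algorithm 1 with parameter $p\in(0,1]$: draw $m\sim\mathrm{Bin}(n,p)$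 and a uniformly random permutation $\tau$ of $\{1,\dots,n\}$, with $m,\tau,\sigma,\pi$ independent; ties between weights are broken by $\tau$ (of two elements of equal weight, the one whose index has the larger $\tau$-value counts as heavier). Maintain the set $T$ of the $r$ heaviest elements seen so far, starting with $r$ dummy elements lighter than all elements of $E$, and start with $\mathrm{ALG}=\emptyset$. The first $m$ elements, the sample, are only observed. Each later element $e$ is added to $\mathrm{ALG}$ if and only if on arrival it enters $T$, the element leaving $T$ is a dummy or in the sample, and $\mathrm{ALG}\cup\{e\}$ is independent in $M$. Then for every $p\in(0,1]$ and all $w_1\ge\dots\ge w_n\ge0$, the output $\mathrm{ALG}$ satisfies $$\mathbb E[w(\mathrm{ALG})]\;\ge\;(-p^2\ln p)\sum_{i=1}^r w_i\;\ge\;(-p^2\ln p)\,\mathbb E_\sigma[w(\mathrm{OPT}(\sigma))],$$ where the first expectation is over $\sigma$, $\pi$ and the internal randomness $(\tau,m)$. In particular, with $p=e^{-1/2}$ Algorithm 1 is a $2e$-competitive online algorithm for $M$. -/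

import Mathlib

/-- Expectation of a bounded real function `f` of a random outcome with discrete law `P`. -/
noncomputable def expect {Ω : Type*} (P : PMF Ω) (f : Ω → ℝ) : ℝ :=
  ∑' ω, (P ω).toReal * f ω

/-- A finite loopless matroid is uniformly dense if `|X| / r(X) ≤ |E| / r(E)` for all nonempty
`X ⊆ E`. (As there are no loops, the denominators are nonzero.) -/
structure UniformlyDense {α : Type*} (M : Matroid α) : Prop where
  finite : M.E.Finite
  loopless : M.Loopless
  density_le : ∀ X ⊆ M.E, X.Nonempty →
    (X.ncard : ℝ) / ((M.eRk X).toNat : ℝ) ≤ (M.E.ncard : ℝ) / (M.eRank.toNat : ℝ)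

section Model

variable {α : Type*} {n : ℕ}

/-- The index set `S` names an independent set of `M`, whose ground set is enumerated as
`e 0, …, e (n - 1)`. -/
def IndepIdx (M : Matroid α) (e : Fin n ≃ M.E) (S : Finset (Fin n)) : Prop :=
  M.Indep ((fun i => (e i : α)) '' (S : Set (Fin n)))

/-- The weights of the elements under the assignment `σ`: element `σ i` receives the `i`-th weight
of the adversary's list `w`, so that element `j` has weight `w (σ⁻¹ j)`. -/
def elemWeight (w : Fin n → ℝ) (σ : Equiv.Perm (Fin n)) : Fin n → ℝ :=
  fun j => w (σ.symm j)

/-- The sum of the first `r` weights of the list `w`, the `r` largest ones if `w` is decreasing. -/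
def topWeight (w : Fin n → ℝ) (r : ℕ) : ℝ :=
  ∑ i ∈ Finset.univ.filter (fun i : Fin n => i.val < r), w i

/-- The total weight of a set of elements. -/
def setWeight (v : Fin n → ℝ) (S : Finset (Fin n)) : ℝ :=
  ∑ j ∈ S, v j

open scoped Classical in
/-- The greedy procedure on the first `k` terms of the sequence `e (σ 0), e (σ 1), …`: an element
is selected if it can be added to those selected before while preserving independence. -/
noncomputable def greedy (M : Matroid α) (e : Fin n ≃ M.E) (σ : Equiv.Perm (Fin n)) :
    ℕ → Finset (Fin n)
  | 0 => ∅
  | k + 1 =>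
    if h : k < n then
      if IndepIdx M e (insert (σ ⟨k, h⟩) (greedy M e σ k)) then
        insert (σ ⟨k, h⟩) (greedy M e σ k)
      else greedy M e σ k
    else greedy M e σ k

/-- `OPT(σ)`: the lexicographically first base of `M` according to `σ`. -/
noncomputable def OPT (M : Matroid α) (e : Fin n ≃ M.E) (σ : Equiv.Perm (Fin n)) :
    Finset (Fin n) :=
  greedy M e σ n

/-- The expected weight of the optimum, `E_σ[w(OPT(σ))]`, in the random assignment model. -/
noncomputable def expectedOPT (M : Matroid α) (e : Fin n ≃ M.E) (w : Fin n → ℝ) : ℝ :=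
  expect (PMF.uniformOfFintype (Equiv.Perm (Fin n))) fun σ =>
    setWeight (elemWeight w σ) (OPT M e σ)

/-! A randomized selection algorithm is given by the law of its random seed and a function `A`:
`A s v π k` is the set accepted after the first `k` arrivals `π 0, …, π (k - 1)`, when the seed is
`s` and the elements have weights `v`. -/

/-- The algorithm is online: it starts with the empty set, at every arrival it either adds the
arriving element or changes nothing, and what it has accepted after `k` arrivals depends only on
the seed, on the first `k` arrivals and on the comparisons between their weights. -/
structure IsOnline {Ω : Type*} (A : Ω → (Fin n → ℝ) → Equiv.Perm (Fin n) → ℕ → Finset (Fin n)) :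
    Prop where
  start : ∀ s v π, A s v π 0 = ∅
  step : ∀ s v π (k : Fin n),
    A s v π (k.val + 1) = A s v π k.val ∨ A s v π (k.val + 1) = insert (π k) (A s v π k.val)
  nonanticipating : ∀ s v v' (π π' : Equiv.Perm (Fin n)) (k : ℕ), k ≤ n →
    (∀ i : Fin n, i.val < k → π i = π' i) →
    (∀ i j : Fin n, i.val < k → j.val < k →
      (v (π i) ≤ v (π j) ↔ v' (π i) ≤ v' (π j))) →
    A s v π k = A s v' π' k

/-- The expected weight `E_{σ,π}[w(ALG)]` of the final set in the random assignment model: the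
assignment `σ`, the arrival order `π` and the seed of the algorithm are independent, and `σ`, `π`
are uniformly random permutations. -/
noncomputable def expectedALG {Ω : Type*} (seed : PMF Ω)
    (A : Ω → (Fin n → ℝ) → Equiv.Perm (Fin n) → ℕ → Finset (Fin n)) (w : Fin n → ℝ) : ℝ :=
  expect (PMF.uniformOfFintype (Equiv.Perm (Fin n))) fun σ =>
    expect (PMF.uniformOfFintype (Equiv.Perm (Fin n))) fun π =>
      expect seed fun s =>
        setWeight (elemWeight w σ) (A s (elemWeight w σ) π n)

/-- `c`-competitiveness in the random assignment model: the algorithm is online, its solution is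
independent at all times, and `c · E[w(ALG)] ≥ E[w(OPT)]` for every list of nonnegative weights
`w 0 ≥ w 1 ≥ …`. -/
structure IsCompetitive {Ω : Type*} (M : Matroid α) (e : Fin n ≃ M.E) (seed : PMF Ω)
    (A : Ω → (Fin n → ℝ) → Equiv.Perm (Fin n) → ℕ → Finset (Fin n)) (c : ℝ) : Prop where
  online : IsOnline A
  indep : ∀ s v π k, IndepIdx M e (A s v π k)
  ratio : ∀ w : Fin n → ℝ, Antitone w → (∀ i, 0 ≤ w i) →
    expectedOPT M e w ≤ c * expectedALG seed A w

/-- Element `j` is heavier than element `i`; ties are broken in favour of the larger `τ`-value. -/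
def Heavier (v : Fin n → ℝ) (τ : Equiv.Perm (Fin n)) (j i : Fin n) : Prop :=
  v i < v j ∨ (v i = v j ∧ τ i < τ j)

/-- The set of the first `k` elements in the arrival order. -/
def seen (π : Equiv.Perm (Fin n)) (k : ℕ) : Finset (Fin n) :=
  Finset.univ.filter fun j => (π.symm j).val < k

open scoped Classical in
/-- The non-dummy part of the set `T` after `k` arrivals: the `r` heaviest elements seen so far, or
all of them if fewer than `r` have been seen (the remaining places are held by dummies). -/
noncomputable def topSet (r : ℕ) (v : Fin n → ℝ) (τ π : Equiv.Perm (Fin n)) (k : ℕ) :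
    Finset (Fin n) :=
  (seen π k).filter fun j => ((seen π k).filter fun i => Heavier v τ i j).card < r

open scoped Classical in
/-- The top-`r` replacement algorithm with an independence check; the seed is the pair of the
tie-breaking permutation `τ` and the sample size `m`. The first `m` elements are only observed. A
later element `j` is added if it enters `T`, the element leaving `T` is in the sample or a dummy,
and the output remains independent. (The set `T` before `j` minus `T` after `j` consists of the
element that leaves, and is empty if a dummy leaves.) -/
noncomputable def topReplaceAlg (M : Matroid α) (e : Fin n ≃ M.E) (r : ℕ)
    (s : Equiv.Perm (Fin n) × ℕ) (v : Fin n → ℝ) (π : Equiv.Perm (Fin n)) :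
    ℕ → Finset (Fin n)
  | 0 => ∅
  | k + 1 =>
    if h : k < n then
      if s.2 ≤ k ∧ π ⟨k, h⟩ ∈ topSet r v s.1 π (k + 1) ∧
          topSet r v s.1 π k \ topSet r v s.1 π (k + 1) ⊆ seen π s.2 ∧
          IndepIdx M e (insert (π ⟨k, h⟩) (topReplaceAlg M e r s v π k)) then
        insert (π ⟨k, h⟩) (topReplaceAlg M e r s v π k)
      else topReplaceAlg M e r s v π k
    else topReplaceAlg M e r s v π k

/-- The law of the seed: `τ` is a uniformly random permutation and, independently, `m` is
binomially distributed with parameters `n` and `p`. -/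
noncomputable def seedLaw (n : ℕ) (p : unitInterval) : PMF (Equiv.Perm (Fin n) × ℕ) :=
  (PMF.uniformOfFintype (Equiv.Perm (Fin n))).bind fun τ =>
    (ProbabilityTheory.binomial n p).toPMF.map fun m => (τ, m)

end Model

/-- The sampling probability `e^{-1/2}`. -/
noncomputable def halfProb : unitInterval :=
  ⟨Real.exp (-1 / 2), (Real.exp_pos _).le, Real.exp_le_one_iff.mpr (by norm_num)⟩

/-!
The elements are replaced by two independent uniformly random permutations. Listing the elements by
weight (ties broken by `τ`) gives a ranking `ρ`, which is uniformly random because renaming the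
elements by any `g` renames the ranking (`IsRanking.mul`). Hence the order `μ = ρ⁻¹ * π` in which
the ranks arrive is uniformly random and independent of the identities `π` of the arrivals. Whether
an arrival is a candidate, that is, enters `T` while a dummy or a sample element leaves, depends
only on `μ` and on the sample size `m`.

*Identities.* The number `c` of candidates before a given one is the number of elements of `T`
outside the sample (`card_candidates`). The accepted elements are among the candidates, so a
candidate is accepted if it is not spanned by the earlier ones. By uniform density these span at
most a fraction `c / r` of the ground set, so over the choice of `π` the candidate is accepted with
probability at least `1 - c / r` (`UniformlyDense.le_card_perm_notMem_spanIdx`).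

*Ranks.* Suppose that one of the `r` heaviest elements arrives at time `k`, after `k` others. It
enters `T`, so it is a candidate if the element `x` leaving `T` is a dummy or in the sample. Since
`r - c` counts the dummies and sample elements of `T`, the expectation of `1 - c / r` on the event
that the arrival is a candidate is an average, over the `r` places `y` of `T`, of the probability
that neither `x` nor `y` is a nonsample element. The first `k` arrivals being in random order, each
of these probabilities is at least `m (m - 1) / (k (k - 1))` (`le_sum_candidateGain`; see `pairProb`
for `k ≤ 1`).

*Summation.* The sum of this bound over `m ≤ k < n` telescopes to at least `m (n - m) / (n - 1)`. The arrival time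
`k` is uniform and `m` is binomial, so each of the `r` heaviest elements is accepted with
probability at least `E[m (n - m)] / (n (n - 1)) = p (1 - p)`, which is at least `-p² log p`. The
weight of the optimum is at most that of the `r` heaviest elements, as it has at most `r` elements.
-/

/-! ### Uniformly random permutations -/

/-- The probability `m (m - 1) / (k (k - 1))` that two given distinct elements of a `k`-element set
are mapped into a given `m`-element subset by a uniformly random permutation. For `k ≤ 1`, where
there are no two distinct elements, it is `1` if the subset is everything and `0` otherwise. -/
noncomputable def pairProb (k m : ℕ) : ℝ :=
  if k ≤ 1 then (if m = k then 1 else 0) else (m * (m - 1) : ℝ) / (k * (k - 1))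

lemma pairProb_nonneg (k m : ℕ) : 0 ≤ pairProb k m := by
  unfold pairProb
  split_ifs with h
  · exact zero_le_one
  · exact le_rfl
  · push Not at h
    have hk : (1 : ℝ) < k := by exact_mod_cast h
    apply div_nonneg
    · rcases Nat.eq_zero_or_pos m with rfl | hm
      · simp
      · have : (1 : ℝ) ≤ m := by exact_mod_cast hm
        nlinarith
    · nlinarith

/-- A uniformly random permutation maps two given distinct elements into `S` with probability
`#S (#S - 1) / (k (k - 1))`. -/
lemma card_perm_pair_mem {β : Type*} [Fintype β] [DecidableEq β] (S : Finset β) {x y : β}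
    (hxy : x ≠ y) :
    (Fintype.card β * Fintype.card β - Fintype.card β) *
        (Finset.univ.filter fun g : Equiv.Perm β => g x ∈ S ∧ g y ∈ S).card
      = (Fintype.card β).factorial * (S.card * S.card - S.card) := by
  classical
  have key : ∀ z ∈ (Finset.univ : Finset β).offDiag,
      (Finset.univ.filter fun g : Equiv.Perm β => g z.1 ∈ S ∧ g z.2 ∈ S).card
        = (Finset.univ.filter fun g : Equiv.Perm β => g x ∈ S ∧ g y ∈ S).card := by
    rintro ⟨x', y'⟩ hz
    simp only [Finset.mem_offDiag, Finset.mem_univ, true_and] at hz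
    -- `h` is a permutation that maps `(x', y')` to `(x, y)`
    let h : Equiv.Perm β := Equiv.swap y (Equiv.swap x x' y') * Equiv.swap x x'
    have hx : h x' = x := by
      have h1 : x ≠ Equiv.swap x x' y' := by
        intro h2
        have := congrArg (Equiv.swap x x') h2
        simp only [Equiv.swap_apply_left, Equiv.swap_apply_self] at this
        exact hz this
      simp only [h, Equiv.Perm.mul_apply, Equiv.swap_apply_right]
      exact Equiv.swap_apply_of_ne_of_ne hxy h1
    have hy : h y' = y := by
      simp [h, Equiv.Perm.mul_apply]
    symm
    refine Finset.card_equiv (Equiv.mulRight h) ?_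
    intro g
    simp [hx, hy]
  have hL := Finset.sum_congr rfl key
  rw [Finset.sum_const, Finset.offDiag_card, Finset.card_univ, smul_eq_mul] at hL
  rw [← hL]
  simp only [Finset.card_filter]
  rw [Finset.sum_comm, ← Fintype.card_perm, ← Finset.card_univ, ← smul_eq_mul, ← Finset.sum_const]
  refine Finset.sum_congr rfl fun g _ => ?_
  rw [← Finset.card_filter, ← Finset.offDiag_card]
  refine Finset.card_bij' (fun z _ => (g z.1, g z.2)) (fun z _ => (g.symm z.1, g.symm z.2))
    ?_ ?_ ?_ ?_ <;> simp +contextual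

/-- A set of at most two elements is mapped into `S` by a uniformly random permutation with
probability at least `pairProb`. -/
lemma pairProb_mul_le_card_perm {β : Type*} [Fintype β] [DecidableEq β] (S U : Finset β)
    (hU : U.card ≤ 2) :
    pairProb (Fintype.card β) S.card * (Fintype.card β).factorial ≤
      ((Finset.univ.filter fun g : Equiv.Perm β => ∀ x ∈ U, g x ∈ S).card : ℝ) := by
  classical
  by_cases hk : Fintype.card β ≤ 1
  · unfold pairProb
    rw [if_pos hk]
    split_ifs with h
    · have hS : S = Finset.univ := (Finset.card_eq_iff_eq_univ S).1 h
      subst hS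
      simp [Finset.card_univ, Fintype.card_perm]
    · simp
  · push Not at hk
    obtain ⟨V, hUV, -, hV⟩ := Finset.exists_subsuperset_card_eq (Finset.subset_univ U) hU
      (by rw [Finset.card_univ]; exact hk)
    obtain ⟨x, y, hxy, rfl⟩ := Finset.card_eq_two.1 hV
    have h1 := card_perm_pair_mem S hxy
    have h2 : (Finset.univ.filter fun g : Equiv.Perm β => g x ∈ S ∧ g y ∈ S).card ≤
        (Finset.univ.filter fun g : Equiv.Perm β => ∀ z ∈ U, g z ∈ S).card := by
      apply Finset.card_le_card
      intro g
      simp only [Finset.mem_filter, Finset.mem_univ, true_and]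
      rintro ⟨hx, hy⟩ z hz
      have := hUV hz
      simp only [Finset.mem_insert, Finset.mem_singleton] at this
      rcases this with rfl | rfl <;> assumption
    refine le_trans ?_ (Nat.cast_le.2 h2)
    unfold pairProb
    rw [if_neg (by omega)]
    have h3 : ∀ a : ℕ, ((a * a - a : ℕ) : ℝ) = a * (a - 1) := by
      intro a
      rw [Nat.cast_sub (Nat.le_mul_self a)]
      push_cast
      ring
    have h4 := congrArg (Nat.cast : ℕ → ℝ) h1
    rw [Nat.cast_mul, Nat.cast_mul, h3, h3] at h4
    have hk' : (1 : ℝ) < Fintype.card β := by exact_mod_cast hk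
    have hpos : (0 : ℝ) < Fintype.card β * (Fintype.card β - 1) := by nlinarith
    rw [div_mul_eq_mul_div, div_le_iff₀ hpos]
    linarith

lemma card_perm_apply_eq {n : ℕ} (k i : Fin n) :
    n * (Finset.univ.filter fun μ : Equiv.Perm (Fin n) => μ k = i).card = n.factorial := by
  have key : ∀ j ∈ (Finset.univ : Finset (Fin n)),
      (Finset.univ.filter fun μ : Equiv.Perm (Fin n) => μ k = j).card
        = (Finset.univ.filter fun μ : Equiv.Perm (Fin n) => μ k = i).card := by
    intro j _
    refine Finset.card_equiv (Equiv.mulLeft (Equiv.swap i j)) ?_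
    intro μ
    simp [Equiv.swap_apply_eq_iff]
  have h := Finset.sum_congr rfl key
  rw [Finset.sum_const, Finset.card_univ, Fintype.card_fin, smul_eq_mul] at h
  rw [← h, ← Finset.card_eq_sum_card_fiberwise (by simp), Finset.card_univ, Fintype.card_perm,
    Fintype.card_fin]

/-! ### The numerical bound -/

/-- For `m ≥ 2` both sides are equal, by telescoping. -/
lemma le_sum_pairProb {m n : ℕ} (hmn : m ≤ n) (hn : 2 ≤ n) :
    (m * (n - m) / (n - 1) : ℝ) ≤ ∑ k ∈ Finset.Ico m n, pairProb k m := by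
  have hn' : (2 : ℝ) ≤ n := by exact_mod_cast hn
  rcases Nat.lt_or_ge m 2 with hm | hm
  · interval_cases m
    · simpa using Finset.sum_nonneg fun k _ => pairProb_nonneg k 0
    · have : pairProb 1 1 ≤ ∑ k ∈ Finset.Ico 1 n, pairProb k 1 :=
        Finset.single_le_sum (fun k _ => pairProb_nonneg k 1) (by simp; omega)
      refine le_trans (le_of_eq ?_) this
      have : (n : ℝ) - 1 ≠ 0 := by linarith
      simp [pairProb, this]
  · apply le_of_eq
    clear hn hn'
    induction n, hmn using Nat.le_induction with
    | base => simp
    | succ k hk ih =>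
      rw [Finset.sum_Ico_succ_top hk, ← ih, pairProb, if_neg (by omega)]
      have h1 : (2 : ℝ) ≤ k := by exact_mod_cast hm.trans hk
      have h2 : (k : ℝ) - 1 ≠ 0 := by linarith
      have h3 : (k : ℝ) ≠ 0 := by linarith
      push_cast
      rw [add_sub_cancel_right]
      field_simp
      ring

lemma sum_binomial_mul (n : ℕ) (p : ℝ) :
    ∑ m ∈ Finset.range (n + 1), (n.choose m * p ^ m * (1 - p) ^ (n - m)) * (m * (n - m) : ℝ)
      = n * (n - 1) * (p * (1 - p)) := by
  have h1 := congrArg (Polynomial.eval p) (bernsteinPolynomial.sum_smul ℝ n)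
  have h2 := congrArg (Polynomial.eval p) (bernsteinPolynomial.sum_mul_smul ℝ n)
  simp only [Polynomial.eval_finsetSum, nsmul_eq_mul, Polynomial.eval_mul, Polynomial.eval_natCast,
    Polynomial.eval_X, Polynomial.eval_pow, bernsteinPolynomial, Polynomial.eval_sub,
    Polynomial.eval_one] at h1 h2
  have hc : ∀ a : ℕ, ((a * (a - 1) : ℕ) : ℝ) = a * (a - 1) := by
    rintro (_ | a) <;> simp
  simp only [hc] at h2
  have : ∀ m ∈ Finset.range (n + 1),
      (n.choose m * p ^ m * (1 - p) ^ (n - m)) * (m * (n - m) : ℝ)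
        = (n - 1) * (m * (n.choose m * p ^ m * (1 - p) ^ (n - m)))
          - (m * (m - 1)) * (n.choose m * p ^ m * (1 - p) ^ (n - m)) := by
    intro m _
    ring
  rw [Finset.sum_congr rfl this, Finset.sum_sub_distrib, ← Finset.mul_sum, h1, h2]
  ring

/-- `-p² log p ≤ p (1 - p)`, as `log (1 / p) ≤ 1 / p - 1`. -/
lemma neg_sq_mul_log_le {p : ℝ} (hp : 0 < p) : -(p ^ 2 * Real.log p) ≤ p * (1 - p) := by
  have h := Real.log_le_sub_one_of_pos (inv_pos.2 hp)
  rw [Real.log_inv] at h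
  have h2 : p ^ 2 * -Real.log p ≤ p ^ 2 * (p⁻¹ - 1) := mul_le_mul_of_nonneg_left h (sq_nonneg p)
  have h3 : p ^ 2 * (p⁻¹ - 1) = p * (1 - p) := by field_simp
  linarith

/-- The average of `pairProb k m` over `k < n`, with `pairProb k m` counted as zero for `k < m`, has
expectation at least `p (1 - p)` if `m` is binomially distributed. -/
lemma mul_one_sub_le_sum_binomial {n : ℕ} (hn : 0 < n) {p : ℝ} (hp : 0 ≤ p) (hp1 : p ≤ 1) :
    p * (1 - p) ≤ ∑ m ∈ Finset.range (n + 1), (n.choose m * p ^ m * (1 - p) ^ (n - m)) *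
      ((∑ k ∈ Finset.Ico m n, pairProb k m) / n) := by
  have hp' : 0 ≤ 1 - p := by linarith
  rcases Nat.lt_or_ge 1 n with h | h
  · have hn' : (1 : ℝ) < n := by exact_mod_cast h
    have h0 : (n : ℝ) - 1 ≠ 0 := by linarith
    have h0' : (n : ℝ) ≠ 0 := by linarith
    calc p * (1 - p) = (∑ m ∈ Finset.range (n + 1),
          (n.choose m * p ^ m * (1 - p) ^ (n - m)) * (m * (n - m) : ℝ)) / (n * (n - 1)) := by
          rw [sum_binomial_mul]
          field_simp
      _ = ∑ m ∈ Finset.range (n + 1),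
          (n.choose m * p ^ m * (1 - p) ^ (n - m)) * ((m * (n - m) / (n - 1) : ℝ) / n) := by
          rw [Finset.sum_div]
          refine Finset.sum_congr rfl fun m _ => ?_
          field_simp
      _ ≤ _ := by
          refine Finset.sum_le_sum fun m hm => ?_
          have := le_sum_pairProb (Nat.lt_succ_iff.1 (Finset.mem_range.1 hm)) h
          gcongr
  -- the denominator `n - 1` vanishes for `n = 1`, where the right-hand side is `1 - p`
  · obtain rfl : n = 1 := by omega
    simp only [Finset.sum_range_succ, Finset.sum_range_zero]
    norm_num [pairProb]
    nlinarith

/-! ### Candidates in terms of arrival times and ranks -/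

section Candidates

variable {n : ℕ}

/-- The set `T` after `k` arrivals, each element being represented by its time of arrival: the times
before `k` at which one of the `r` heaviest elements seen so far arrives. The element that arrives
at time `l` has rank `μ l` among all elements, the heaviest one having rank `0`. -/
def topTimes (r : ℕ) (μ : Equiv.Perm (Fin n)) (k : ℕ) : Finset (Fin n) :=
  Finset.univ.filter fun j => j.val < k ∧
    (Finset.univ.filter fun l : Fin n => l.val < k ∧ μ l < μ j).card < r

/-- The candidates are the times outside the sample, i.e. from `m` on, at which an element enters
`T` while only a dummy or an element of the sample leaves `T`. -/
def IsCandidate (r m : ℕ) (μ : Equiv.Perm (Fin n)) (j : Fin n) : Prop :=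
  m ≤ j.val ∧ j ∈ topTimes r μ (j.val + 1) ∧
    ∀ l ∈ topTimes r μ j.val, l ∉ topTimes r μ (j.val + 1) → l.val < m

instance (r m : ℕ) (μ : Equiv.Perm (Fin n)) : DecidablePred (IsCandidate r m μ) :=
  fun _ => inferInstanceAs (Decidable (_ ∧ _ ∧ _))

/-- The candidates before time `k`. -/
def candidates (r m : ℕ) (μ : Equiv.Perm (Fin n)) (k : ℕ) : Finset (Fin n) :=
  Finset.univ.filter fun j => j.val < k ∧ IsCandidate r m μ j

lemma mem_topTimes {r : ℕ} {μ : Equiv.Perm (Fin n)} {k : ℕ} {j : Fin n} :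
    j ∈ topTimes r μ k ↔ j.val < k ∧
      (Finset.univ.filter fun l : Fin n => l.val < k ∧ μ l < μ j).card < r := by
  simp [topTimes]

lemma card_filter_card_lt {ι : Type*} [DecidableEq ι] (f : ι → Fin n) (hf : Function.Injective f)
    (r : ℕ) (s : Finset ι) :
    (s.filter fun j => (s.filter fun l => f l < f j).card < r).card = min r s.card := by
  induction s using Finset.induction_on_max_value f with
  | empty => simp
  | insert a s ha hmax ih =>
    have h1 : ∀ x ∈ s, f x < f a := fun x hx =>
      lt_of_le_of_ne (hmax x hx) fun h => ha (hf h ▸ hx)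
    have ha' : ((insert a s).filter fun l => f l < f a) = s := by
      ext l
      simp only [Finset.mem_filter, Finset.mem_insert]
      constructor
      · rintro ⟨rfl | h, h'⟩
        · exact absurd h' (lt_irrefl _)
        · exact h
      · exact fun h => ⟨Or.inr h, h1 l h⟩
    have hs : ∀ x ∈ s, ((insert a s).filter fun l => f l < f x) = s.filter fun l => f l < f x := by
      intro x hx
      rw [Finset.filter_insert, if_neg (h1 x hx).asymm]
    rw [Finset.filter_insert, ha', Finset.filter_congr (fun x hx => by rw [hs x hx])]
    split_ifs with h
    · rw [Finset.card_insert_of_notMem (fun h => ha (Finset.mem_of_mem_filter _ h)), ih,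
        Finset.card_insert_of_notMem ha]
      omega
    · rw [ih, Finset.card_insert_of_notMem ha]
      omega

lemma card_topTimes (r : ℕ) (μ : Equiv.Perm (Fin n)) {k : ℕ} (hk : k ≤ n) :
    (topTimes r μ k).card = min r k := by
  have h := card_filter_card_lt μ μ.injective r (Finset.univ.filter fun j : Fin n => j.val < k)
  simp only [Finset.filter_filter] at h
  rw [topTimes, h, Fin.card_filter_val_lt, min_eq_right hk]

lemma lt_of_mem_topTimes {r : ℕ} {μ : Equiv.Perm (Fin n)} {k : ℕ} {j : Fin n}
    (h : j ∈ topTimes r μ k) : j.val < k := by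
  simp only [topTimes, Finset.mem_filter] at h
  exact h.2.1

lemma mem_topTimes_of_mem_succ {r : ℕ} {μ : Equiv.Perm (Fin n)} {k : ℕ} {j : Fin n}
    (hj : j.val < k) (h : j ∈ topTimes r μ (k + 1)) : j ∈ topTimes r μ k := by
  simp only [topTimes, Finset.mem_filter, Finset.mem_univ, true_and] at h ⊢
  refine ⟨hj, lt_of_le_of_lt (Finset.card_le_card ?_) h.2⟩
  intro l
  simp only [Finset.mem_filter, Finset.mem_univ, true_and]
  exact fun hl => ⟨by omega, hl.2⟩

lemma topTimes_succ_subset (r : ℕ) (μ : Equiv.Perm (Fin n)) (k : Fin n) :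
    topTimes r μ (k.val + 1) ⊆ insert k (topTimes r μ k.val) := by
  intro j hj
  rw [Finset.mem_insert]
  have := lt_of_mem_topTimes hj
  rcases Nat.lt_or_ge j.val k.val with h | h
  · exact Or.inr (mem_topTimes_of_mem_succ h hj)
  · exact Or.inl (Fin.ext (by omega))

/-- At most one element leaves `T` on each arrival. -/
lemma card_topTimes_sdiff_le (r : ℕ) (μ : Equiv.Perm (Fin n)) (k : Fin n) :
    (topTimes r μ k.val \ topTimes r μ (k.val + 1)).card ≤ 1 := by
  have h1 := card_topTimes r μ k.isLt.le
  have h2 := card_topTimes r μ (Nat.succ_le_of_lt k.isLt)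
  have h3 := Finset.card_inter_add_card_sdiff (topTimes r μ k.val) (topTimes r μ (k.val + 1))
  have h4 : (topTimes r μ (k.val + 1)).card ≤
      (topTimes r μ k.val ∩ topTimes r μ (k.val + 1)).card + 1 := by
    refine le_trans (Finset.card_le_card ?_) (Finset.card_insert_le k _)
    intro j hj
    have := topTimes_succ_subset r μ k hj
    simp only [Finset.mem_insert, Finset.mem_inter] at this ⊢
    tauto
  simp only [Nat.succ_eq_add_one] at h2
  omega

/-- An element that does not enter `T` leaves `T` unchanged. -/
lemma topTimes_succ_eq_of_notMem {r : ℕ} {μ : Equiv.Perm (Fin n)} {k : Fin n}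
    (h : k ∉ topTimes r μ (k.val + 1)) :
    topTimes r μ (k.val + 1) = topTimes r μ k.val := by
  have h1 := card_topTimes r μ k.isLt.le
  have h2 := card_topTimes r μ (Nat.succ_le_of_lt k.isLt)
  simp only [Nat.succ_eq_add_one] at h2
  refine Finset.eq_of_subset_of_card_le ?_ (by omega)
  intro j hj
  have := topTimes_succ_subset r μ k hj
  rw [Finset.mem_insert] at this
  rcases this with rfl | h'
  · exact absurd hj h
  · exact h'

lemma notMem_topTimes (r : ℕ) (μ : Equiv.Perm (Fin n)) (k : Fin n) :
    k ∉ topTimes r μ k.val :=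
  fun h => lt_irrefl _ (lt_of_mem_topTimes h)

lemma candidates_succ (r m : ℕ) (μ : Equiv.Perm (Fin n)) (k : Fin n) :
    candidates r m μ (k.val + 1) =
      if IsCandidate r m μ k then insert k (candidates r m μ k.val)
      else candidates r m μ k.val := by
  ext j
  have : j.val < k.val + 1 ↔ j = k ∨ j.val < k.val := by
    rw [Fin.ext_iff]; omega
  split_ifs with h
  · simp only [candidates, Finset.mem_filter, Finset.mem_univ, true_and, Finset.mem_insert, this]
    constructor
    · tauto
    · rintro (rfl | h')
      · exact ⟨Or.inl rfl, h⟩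
      · tauto
  · simp only [candidates, Finset.mem_filter, Finset.mem_univ, true_and, this]
    constructor
    · rintro ⟨rfl | h', h''⟩
      · exact absurd h'' h
      · exact ⟨h', h''⟩
    · tauto

/-- The number of candidates so far is the number of elements of `T` outside the sample: a candidate
raises the latter number by one, and any other element that enters `T` replaces an element outside
the sample. -/
lemma card_candidates (r m : ℕ) (μ : Equiv.Perm (Fin n)) {k : ℕ} (hk : k ≤ n) :
    (candidates r m μ k).card = ((topTimes r μ k).filter fun j => m ≤ j.val).card := by
  induction k with
  | zero => simp [candidates, topTimes]
  | succ k ih =>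
    have ih := ih (by omega)
    obtain ⟨t, rfl⟩ : ∃ t : Fin n, t.val = k := ⟨⟨k, hk⟩, rfl⟩
    have hL := card_topTimes_sdiff_le r μ t
    have hsub := topTimes_succ_subset r μ t
    have hnot := notMem_topTimes r μ t
    have hcard1 := card_topTimes r μ t.isLt.le
    have hcard2 := card_topTimes r μ (Nat.succ_le_of_lt t.isLt)
    rw [candidates_succ]
    by_cases hm : m ≤ t.val
    · by_cases ht : t ∈ topTimes r μ (t.val + 1)
      · by_cases hc : ∀ l ∈ topTimes r μ t.val, l ∉ topTimes r μ (t.val + 1) → l.val < m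
        · rw [if_pos ⟨hm, ht, hc⟩, Finset.card_insert_of_notMem (by simp [candidates]), ih,
            ← Finset.card_insert_of_notMem (a := t) (by simp [hnot])]
          congr 1
          ext j
          simp only [Finset.mem_insert, Finset.mem_filter]
          constructor
          · rintro (rfl | ⟨h1, h2⟩)
            · exact ⟨ht, hm⟩
            · refine ⟨?_, h2⟩
              by_contra h3
              exact absurd (hc j h1 h3) (by omega)
          · rintro ⟨h1, h2⟩
            have := hsub h1
            rw [Finset.mem_insert] at this
            tauto
        · rw [if_neg (fun h => hc h.2.2), ih]
          push Not at hc
          obtain ⟨l, hl1, hl2, hl3⟩ := hc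
          -- the leaving element `l` is replaced by `t`
          have huniq : ∀ j ∈ topTimes r μ t.val, j ∉ topTimes r μ (t.val + 1) → j = l := by
            intro j h1 h2
            exact Finset.card_le_one.1 hL j (Finset.mem_sdiff.2 ⟨h1, h2⟩) l
              (Finset.mem_sdiff.2 ⟨hl1, hl2⟩)
          have e : ((topTimes r μ (t.val + 1)).filter fun j => m ≤ j.val) =
              insert t (((topTimes r μ t.val).filter fun j => m ≤ j.val).erase l) := by
            ext j
            simp only [Finset.mem_insert, Finset.mem_filter, Finset.mem_erase]
            constructor
            · rintro ⟨h1, h2⟩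
              have := hsub h1
              rw [Finset.mem_insert] at this
              rcases this with h3 | h3
              · exact Or.inl h3
              · refine Or.inr ⟨?_, h3, h2⟩
                rintro rfl
                exact hl2 h1
            · rintro (rfl | ⟨h1, h2, h3⟩)
              · exact ⟨ht, hm⟩
              · refine ⟨?_, h3⟩
                by_contra h4
                exact h1 (huniq j h2 h4)
          rw [e, Finset.card_insert_of_notMem (by simp [hnot]),
            Finset.card_erase_add_one (Finset.mem_filter.2 ⟨hl1, hl3⟩)]
      · rw [if_neg (fun h => ht h.2.1), ih, topTimes_succ_eq_of_notMem ht]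
    · rw [if_neg (fun h => hm h.1), ih]
      have h0 : ∀ a : ℕ, a ≤ t.val + 1 → ((topTimes r μ a).filter fun j => m ≤ j.val) = ∅ := by
        intro a ha
        refine Finset.filter_eq_empty_iff.2 fun j hj => ?_
        have := lt_of_mem_topTimes hj
        omega
      rw [h0 _ (by omega), h0 _ le_rfl]

lemma card_candidates_le (r m : ℕ) (μ : Equiv.Perm (Fin n)) {k : ℕ} (hk : k ≤ n) :
    (candidates r m μ k).card ≤ r := by
  rw [card_candidates r m μ hk]
  refine (Finset.card_filter_le _ _).trans ?_
  rw [card_topTimes r μ hk]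
  exact min_le_left _ _

/-- An element among the `r` heaviest of all enters `T` on arrival. -/
lemma mem_topTimes_of_lt {r : ℕ} {μ : Equiv.Perm (Fin n)} {j : Fin n} (h : (μ j).val < r) :
    j ∈ topTimes r μ (j.val + 1) := by
  simp only [topTimes, Finset.mem_filter, Finset.mem_univ, true_and]
  refine ⟨Nat.lt_succ_self _, lt_of_le_of_lt ?_ h⟩
  rw [← Fin.card_Iio (μ j), ← Finset.card_map μ.toEmbedding]
  apply Finset.card_le_card
  intro x
  simp only [Finset.mem_map, Finset.mem_filter, Finset.mem_univ, true_and, Finset.mem_Iio]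
  rintro ⟨l, hl, rfl⟩
  exact hl.2

/-- Permuting the first arrivals among themselves permutes `T` accordingly. -/
lemma mem_topTimes_mul {r : ℕ} {μ g : Equiv.Perm (Fin n)} {k : ℕ}
    (hg : ∀ l : Fin n, (g l).val < k ↔ l.val < k) (j : Fin n) :
    j ∈ topTimes r (μ * g) k ↔ g j ∈ topTimes r μ k := by
  have : (Finset.univ.filter fun l : Fin n => l.val < k ∧ (μ * g) l < (μ * g) j).card =
      (Finset.univ.filter fun l : Fin n => l.val < k ∧ μ l < μ (g j)).card := by
    refine Finset.card_equiv g ?_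
    intro l
    rw [Finset.mem_filter, Finset.mem_filter]
    simp [hg]
  rw [mem_topTimes, mem_topTimes, this, hg]

/-! ### The chance of being a candidate -/

lemma card_subtype_val_lt {k : ℕ} (hk : k ≤ n) :
    Fintype.card {j : Fin n // j.val < k} = k := by
  rw [Fintype.card_subtype, Fin.card_filter_val_lt, min_eq_right hk]

/-- If the first `k` arrivals are permuted uniformly at random, then at most two given ones of them
all become part of the sample with probability at least `pairProb k m`. -/
lemma pairProb_mul_le_card_ofSubtype {k m : ℕ} (hk : k ≤ n) (hm : m ≤ k) (U : Finset (Fin n))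
    (hU : U.card ≤ 2) (hUk : ∀ l ∈ U, l.val < k) :
    pairProb k m * k.factorial ≤
      ((Finset.univ.filter fun g : Equiv.Perm {j : Fin n // j.val < k} =>
        ∀ l ∈ U, (Equiv.Perm.ofSubtype g l).val < m).card : ℝ) := by
  let S : Finset {j : Fin n // j.val < k} := Finset.univ.filter fun j => j.val.val < m
  have hS : S.card = m := by
    have : (S.map (Function.Embedding.subtype _)).card = m := by
      have h : S.map (Function.Embedding.subtype _) =
          Finset.univ.filter fun j : Fin n => j.val < m := by
        ext j
        simp only [S, Finset.mem_map, Finset.mem_filter, Finset.mem_univ, true_and,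
          Function.Embedding.subtype_apply, Subtype.exists, exists_and_left, exists_prop]
        constructor
        · rintro ⟨a, h1, h2, rfl⟩
          exact h1
        · exact fun h => ⟨j, h, by omega, rfl⟩
      rw [h, Fin.card_filter_val_lt, min_eq_right (hm.trans hk)]
    rwa [Finset.card_map] at this
  have h := pairProb_mul_le_card_perm S (U.subtype fun j => j.val < k)
    ((Finset.card_subtype _ _).trans_le ((Finset.card_filter_le _ _).trans hU))
  rw [hS, card_subtype_val_lt hk] at h
  refine h.trans (Nat.cast_le.2 (Finset.card_le_card ?_))
  intro g
  simp only [Finset.mem_filter, Finset.mem_univ, true_and, Finset.mem_subtype, S]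
  intro h l hl
  have := h ⟨l, hUk l hl⟩ hl
  rwa [← Equiv.Perm.ofSubtype_apply_coe] at this

/-- The number of dummies and sample elements in `T` before the arrival at time `k` if this arrival
is a candidate, and zero otherwise. -/
noncomputable def candidateGain (r m : ℕ) (k : Fin n) (μ : Equiv.Perm (Fin n)) : ℝ :=
  if IsCandidate r m μ k then (r : ℝ) - (candidates r m μ k.val).card else 0

/-- The candidate gain after a permutation `g` of the arrivals before `k`, as a sum of indicators
of events that at most two given arrivals are moved into the sample. -/
lemma candidateGain_mul_inv {r m : ℕ} {k : Fin n} (hm : m ≤ k.val) {μ : Equiv.Perm (Fin n)}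
    (hμ : (μ k).val < r) (g : Equiv.Perm {j : Fin n // j.val < k.val}) :
    candidateGain r m k (μ * (Equiv.Perm.ofSubtype g)⁻¹) =
      ((r : ℝ) - (topTimes r μ k.val).card) *
          (if ∀ l ∈ topTimes r μ k.val \ topTimes r μ (k.val + 1),
            (Equiv.Perm.ofSubtype g l).val < m then 1 else 0) +
        ∑ y ∈ topTimes r μ k.val,
          if ∀ l ∈ insert y (topTimes r μ k.val \ topTimes r μ (k.val + 1)),
            (Equiv.Perm.ofSubtype g l).val < m then 1 else 0 := by
  set G : Equiv.Perm (Fin n) := Equiv.Perm.ofSubtype g with hG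
  have hGk : G k = k := Equiv.Perm.ofSubtype_apply_of_not_mem g (lt_irrefl _)
  have hGlt : ∀ l : Fin n, (G l).val < k.val ↔ l.val < k.val := fun l =>
    Equiv.Perm.ofSubtype_apply_mem_iff_mem g l
  have hinv : ∀ l : Fin n, (G⁻¹ l).val < k.val ↔ l.val < k.val := by
    intro l
    rw [← hGlt]
    simp
  have hinv' : ∀ l : Fin n, (G⁻¹ l).val < k.val + 1 ↔ l.val < k.val + 1 := by
    intro l
    have h1 : l = k ↔ G⁻¹ l = k := by
      rw [Equiv.Perm.inv_eq_iff_eq, hGk]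
    have h2 := hinv l
    rw [Fin.ext_iff, Fin.ext_iff] at h1
    omega
  have hk : k ∈ topTimes r (μ * G⁻¹) (k.val + 1) := by
    apply mem_topTimes_of_lt
    rw [Equiv.Perm.mul_apply, Equiv.Perm.inv_eq_iff_eq.2 hGk.symm]
    exact hμ
  have hcand : IsCandidate r m (μ * G⁻¹) k ↔
      ∀ l ∈ topTimes r μ k.val \ topTimes r μ (k.val + 1), (G l).val < m := by
    simp only [IsCandidate, hm, hk, true_and, mem_topTimes_mul hinv, mem_topTimes_mul hinv',
      Finset.mem_sdiff]
    constructor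
    · intro h l hl
      exact h (G l) (by simpa using hl.1) (by simpa using hl.2)
    · intro h l h1 h2
      simpa using h (G⁻¹ l) ⟨h1, h2⟩
  have hcard : ((candidates r m (μ * G⁻¹) k.val).card : ℝ) =
      (topTimes r μ k.val).card - ((topTimes r μ k.val).filter fun y => (G y).val < m).card := by
    rw [card_candidates r m _ k.isLt.le, eq_sub_iff_add_eq, add_comm, ← Nat.cast_add,
      ← Finset.card_filter_add_card_filter_not (s := topTimes r μ k.val) fun y => (G y).val < m]
    congr 2
    refine Finset.card_equiv G⁻¹ ?_
    intro l
    simp [mem_topTimes_mul hinv]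
  rw [candidateGain]
  by_cases h : ∀ l ∈ topTimes r μ k.val \ topTimes r μ (k.val + 1), (G l).val < m
  · rw [if_pos (hcand.2 h), if_pos h, hcard, Finset.card_filter]
    simp only [Finset.forall_mem_insert]
    push_cast
    have : ∀ y ∈ topTimes r μ k.val, (if (G y).val < m ∧
        ∀ l ∈ topTimes r μ k.val \ topTimes r μ (k.val + 1), (G l).val < m then (1 : ℝ) else 0)
        = if (G y).val < m then 1 else 0 := by
      intro y _
      exact if_congr (and_iff_left h) rfl rfl
    rw [Finset.sum_congr rfl this]
    ring
  · rw [if_neg (fun h' => h (hcand.1 h')), if_neg h]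
    rw [Finset.sum_eq_zero]
    · simp
    · intro y _
      rw [if_neg (fun h' => h fun l hl => h' l (Finset.mem_insert_of_mem hl))]

lemma le_sum_candidateGain_mul_inv {r m : ℕ} {k : Fin n} (hm : m ≤ k.val)
    {μ : Equiv.Perm (Fin n)} (hμ : (μ k).val < r) :
    r * (pairProb k m * k.val.factorial) ≤
      ∑ g : Equiv.Perm {j : Fin n // j.val < k.val},
        candidateGain r m k (μ * (Equiv.Perm.ofSubtype g)⁻¹) := by
  simp only [candidateGain_mul_inv hm hμ]
  rw [Finset.sum_add_distrib, ← Finset.mul_sum, Finset.sum_comm]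
  have hL := card_topTimes_sdiff_le r μ k
  have hlt : ∀ l ∈ topTimes r μ k.val \ topTimes r μ (k.val + 1), l.val < k.val := fun l hl =>
    lt_of_mem_topTimes (Finset.mem_sdiff.1 hl).1
  have h1 := pairProb_mul_le_card_ofSubtype k.isLt.le hm _ (hL.trans one_le_two) hlt
  have h2 : ∀ y ∈ topTimes r μ k.val, pairProb k m * k.val.factorial ≤
      ∑ g : Equiv.Perm {j : Fin n // j.val < k.val},
        if ∀ l ∈ insert y (topTimes r μ k.val \ topTimes r μ (k.val + 1)),
          (Equiv.Perm.ofSubtype g l).val < m then (1 : ℝ) else 0 := by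
    intro y hy
    rw [Finset.sum_boole]
    refine pairProb_mul_le_card_ofSubtype k.isLt.le hm _
      ((Finset.card_insert_le _ _).trans (by omega)) ?_
    simp only [Finset.forall_mem_insert]
    exact ⟨lt_of_mem_topTimes hy, hlt⟩
  have h3 := Finset.sum_le_sum h2
  rw [Finset.sum_const, nsmul_eq_mul] at h3
  rw [Finset.sum_boole]
  have h4 : (0 : ℝ) ≤ r - (topTimes r μ k.val).card := by
    rw [card_topTimes r μ k.isLt.le, sub_nonneg]
    exact_mod_cast min_le_left _ _
  have h5 := mul_le_mul_of_nonneg_left h1 h4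
  linarith

/-- The expected candidate gain at time `k`, given that an element of rank `i < r` arrives at this
time, is at least `r * pairProb k m`. -/
lemma le_sum_candidateGain {r m : ℕ} {k i : Fin n} (hm : m ≤ k.val) (hi : i.val < r) :
    r * pairProb k m * (n.factorial / n) ≤
      ∑ μ ∈ Finset.univ.filter (fun μ : Equiv.Perm (Fin n) => μ k = i),
        candidateGain r m k μ := by
  set F := Finset.univ.filter (fun μ : Equiv.Perm (Fin n) => μ k = i) with hF
  have hcard : (n.factorial / n : ℝ) = F.card := by
    have hn : (n : ℝ) ≠ 0 := by
      have := k.isLt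
      exact_mod_cast (by omega : n ≠ 0)
    rw [div_eq_iff hn, ← card_perm_apply_eq k i]
    push_cast
    ring
  have hk : (0 : ℝ) < k.val.factorial := by exact_mod_cast Nat.factorial_pos _
  have h1 : ∑ μ ∈ F, ∑ g : Equiv.Perm {j : Fin n // j.val < k.val},
      candidateGain r m k (μ * (Equiv.Perm.ofSubtype g)⁻¹) =
      k.val.factorial * ∑ μ ∈ F, candidateGain r m k μ := by
    rw [Finset.sum_comm]
    have : ∀ g ∈ (Finset.univ : Finset (Equiv.Perm {j : Fin n // j.val < k.val})),
        ∑ μ ∈ F, candidateGain r m k (μ * (Equiv.Perm.ofSubtype g)⁻¹) =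
          ∑ μ ∈ F, candidateGain r m k μ := by
      intro g _
      refine Finset.sum_equiv (Equiv.mulRight (Equiv.Perm.ofSubtype g)⁻¹) ?_ (fun μ _ => rfl)
      intro μ
      have hGk : (Equiv.Perm.ofSubtype g)⁻¹ k = k := by
        rw [Equiv.Perm.inv_eq_iff_eq]
        exact (Equiv.Perm.ofSubtype_apply_of_not_mem g (lt_irrefl _)).symm
      simp only [hF, Finset.mem_filter, Finset.mem_univ, true_and, Equiv.coe_mulRight,
        Equiv.Perm.mul_apply, hGk]
    rw [Finset.sum_congr rfl this, Finset.sum_const, nsmul_eq_mul, Finset.card_univ,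
      Fintype.card_perm, card_subtype_val_lt k.isLt.le]
  have h2 : (F.card : ℝ) * (r * (pairProb k m * k.val.factorial)) ≤
      ∑ μ ∈ F, ∑ g : Equiv.Perm {j : Fin n // j.val < k.val},
        candidateGain r m k (μ * (Equiv.Perm.ofSubtype g)⁻¹) := by
    rw [← nsmul_eq_mul, ← Finset.sum_const]
    refine Finset.sum_le_sum fun μ hμ => le_sum_candidateGain_mul_inv hm ?_
    rw [(Finset.mem_filter.1 hμ).2]
    exact hi
  rw [h1] at h2
  rw [hcard]
  refine le_of_mul_le_mul_left ?_ hk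
  linarith

/-- Summed over all rank orders of the arrivals, the candidate gain at the arrival time of the
element of rank `i < r`. -/
lemma le_sum_candidateGain_symm {r m : ℕ} (i : Fin n) (hi : i.val < r) :
    r * ((∑ k ∈ Finset.Ico m n, pairProb k m) / n) * n.factorial ≤
      ∑ μ : Equiv.Perm (Fin n), candidateGain r m (μ.symm i) μ := by
  have h1 : ∑ μ : Equiv.Perm (Fin n), candidateGain r m (μ.symm i) μ =
      ∑ k : Fin n, ∑ μ ∈ Finset.univ.filter (fun μ : Equiv.Perm (Fin n) => μ k = i),
        candidateGain r m k μ := by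
    rw [← Finset.sum_fiberwise_of_maps_to (s := Finset.univ) (t := Finset.univ)
      (g := fun μ : Equiv.Perm (Fin n) => μ.symm i) (fun _ _ => Finset.mem_univ _)]
    refine Finset.sum_congr rfl fun k _ => ?_
    refine Finset.sum_congr ?_ ?_
    · ext μ
      rw [Finset.mem_filter, Finset.mem_filter, Equiv.symm_apply_eq]
      simp [eq_comm]
    · intro μ hμ
      rw [← (Finset.mem_filter.1 hμ).2, Equiv.symm_apply_apply]
  rw [h1]
  have h2 : ∑ k ∈ Finset.Ico m n, pairProb k m =
      ∑ k : Fin n, if m ≤ k.val then pairProb k m else 0 := by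
    rw [Fin.sum_univ_eq_sum_range (fun k => if m ≤ k then pairProb k m else 0) n,
      ← Finset.sum_filter]
    congr 1
    ext k
    simp only [Finset.mem_Ico, Finset.mem_filter, Finset.mem_range]
    tauto
  rw [h2, mul_div_assoc', div_mul_eq_mul_div, mul_div_assoc, Finset.mul_sum, Finset.sum_mul]
  refine Finset.sum_le_sum fun k _ => ?_
  split_ifs with hm
  · exact le_sum_candidateGain hm hi
  · rw [mul_zero, zero_mul]
    refine Finset.sum_nonneg fun μ _ => ?_
    rw [candidateGain, if_neg (fun h => hm h.1)]

end Candidates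

section Dense

variable {α : Type*} {n : ℕ}

/-! ### Uniform density -/

/-- The set of elements of the matroid with indices in `S`. -/
def elems (M : Matroid α) (e : Fin n ≃ M.E) (S : Finset (Fin n)) : Set α :=
  (fun i => (e i : α)) '' (S : Set (Fin n))

lemma encard_elems (M : Matroid α) (e : Fin n ≃ M.E) (S : Finset (Fin n)) :
    (elems M e S).encard = S.card := by
  have h : Function.Injective fun i => (e i : α) := Subtype.val_injective.comp e.injective
  rw [elems, h.encard_image, Set.encard_coe_eq_coe_finsetCard]

lemma elems_subset_ground (M : Matroid α) (e : Fin n ≃ M.E) (S : Finset (Fin n)) :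
    elems M e S ⊆ M.E := by
  rintro _ ⟨i, -, rfl⟩
  exact (e i).2

open scoped Classical in
/-- The indices of the elements spanned by the elements with indices in `D`. -/
noncomputable def spanIdx (M : Matroid α) (e : Fin n ≃ M.E) (D : Finset (Fin n)) :
    Finset (Fin n) :=
  Finset.univ.filter fun j => (e j : α) ∈ M.closure (elems M e D)

lemma mem_spanIdx {M : Matroid α} {e : Fin n ≃ M.E} {D : Finset (Fin n)} {j : Fin n} :
    j ∈ spanIdx M e D ↔ (e j : α) ∈ M.closure (elems M e D) := by
  simp [spanIdx]

lemma subset_spanIdx (M : Matroid α) (e : Fin n ≃ M.E) (D : Finset (Fin n)) :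
    D ⊆ spanIdx M e D := fun j hj =>
  mem_spanIdx.2 (M.subset_closure _ (elems_subset_ground M e D) ⟨j, hj, rfl⟩)

/-- In a uniformly dense matroid, `c` elements span at most `c n / r` elements. -/
lemma UniformlyDense.mul_card_spanIdx_le {M : Matroid α} (e : Fin n ≃ M.E) {r : ℕ}
    (hr : M.eRank = (r : ℕ∞)) (hM : UniformlyDense M) (D : Finset (Fin n)) :
    r * (spanIdx M e D).card ≤ n * D.card := by
  rcases Nat.eq_zero_or_pos r with rfl | hr0
  · simp
  have hcl : elems M e (spanIdx M e D) = M.closure (elems M e D) := by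
    ext x
    constructor
    · rintro ⟨j, hj, rfl⟩
      exact mem_spanIdx.1 hj
    · intro hx
      refine ⟨e.symm ⟨x, M.closure_subset_ground _ hx⟩, ?_, by simp⟩
      rw [Finset.mem_coe, mem_spanIdx]
      simpa using hx
  rcases (spanIdx M e D).eq_empty_or_nonempty with h | h
  · simp [h]
  have hne : (elems M e (spanIdx M e D)).Nonempty := by
    obtain ⟨j, hj⟩ := h
    exact ⟨_, j, hj, rfl⟩
  have hrk : M.eRk (elems M e (spanIdx M e D)) ≤ D.card := by
    rw [hcl, M.eRk_closure_eq, ← encard_elems M e D]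
    exact M.eRk_le_encard _
  have hrk0 : M.eRk (elems M e (spanIdx M e D)) ≠ 0 := by
    rw [Ne, M.eRk_eq_zero_iff (elems_subset_ground M e _)]
    have := hM.loopless
    rw [M.loops_eq_empty, Set.subset_empty_iff]
    exact hne.ne_empty
  obtain ⟨k, hk⟩ := ENat.ne_top_iff_exists.1 (hrk.trans_lt (ENat.natCast_lt_top _)).ne
  rw [← hk] at hrk hrk0
  have hkD : k ≤ D.card := by exact_mod_cast hrk
  have hk0 : 0 < k := Nat.pos_of_ne_zero (by exact_mod_cast hrk0)
  have hd := hM.density_le _ (elems_subset_ground M e _) hne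
  have hE : M.E.ncard = n := by
    rw [← Nat.card_coe_set_eq, ← Nat.card_congr e, Nat.card_eq_fintype_card, Fintype.card_fin]
  rw [← hk, hr, hE, Set.ncard_def, encard_elems, ENat.toNat_natCast, ENat.toNat_natCast, ENat.toNat_natCast,
    div_le_div_iff₀ (by exact_mod_cast hk0) (by exact_mod_cast hr0)] at hd
  have hd' : (spanIdx M e D).card * r ≤ n * k := by exact_mod_cast hd
  calc r * (spanIdx M e D).card = (spanIdx M e D).card * r := mul_comm _ _
    _ ≤ n * k := hd'
    _ ≤ n * D.card := Nat.mul_le_mul_left _ hkD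

lemma card_mul_card_perm_mem_spanIdx (M : Matroid α) (e : Fin n ≃ M.E) (D : Finset (Fin n))
    {t : Fin n} (ht : t ∉ D) :
    Dᶜ.card * (Finset.univ.filter fun π : Equiv.Perm (Fin n) =>
        π t ∈ spanIdx M e (D.map π.toEmbedding)).card + n.factorial * D.card
      = ∑ π : Equiv.Perm (Fin n), (spanIdx M e (D.map π.toEmbedding)).card := by
  have key : ∀ s ∈ Dᶜ, (Finset.univ.filter fun π : Equiv.Perm (Fin n) =>
        π s ∈ spanIdx M e (D.map π.toEmbedding)).card =
      (Finset.univ.filter fun π : Equiv.Perm (Fin n) =>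
        π t ∈ spanIdx M e (D.map π.toEmbedding)).card := by
    intro s hs
    refine Finset.card_equiv (Equiv.mulRight (Equiv.swap s t)) ?_
    intro π
    have : D.map (π * Equiv.swap s t).toEmbedding = D.map π.toEmbedding := by
      rw [Finset.map_eq_image, Finset.map_eq_image]
      refine Finset.image_congr fun x hx => ?_
      have h1 : x ≠ s := fun h => Finset.mem_compl.1 hs (h ▸ hx)
      have h2 : x ≠ t := fun h => ht (h ▸ hx)
      simp [Equiv.swap_apply_of_ne_of_ne h1 h2]
    simp [this]
  have h1 := Finset.sum_congr rfl key
  rw [Finset.sum_const, smul_eq_mul] at h1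
  have h2 : ∀ π : Equiv.Perm (Fin n), (spanIdx M e (D.map π.toEmbedding)).card =
      (∑ s ∈ Dᶜ, if π s ∈ spanIdx M e (D.map π.toEmbedding) then 1 else 0) + D.card := by
    intro π
    have h3 : (spanIdx M e (D.map π.toEmbedding)).card =
        ∑ s, if π s ∈ spanIdx M e (D.map π.toEmbedding) then 1 else 0 := by
      rw [← Finset.card_filter]
      refine Finset.card_equiv π.symm ?_
      simp
    rw [h3, ← Finset.sum_compl_add_sum D, Finset.card_eq_sum_ones]
    congr 1
    refine Finset.sum_congr rfl fun s hs => ?_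
    exact if_pos (subset_spanIdx M e _ (Finset.mem_map_of_mem π.toEmbedding hs))
  rw [Finset.sum_congr rfl (fun π _ => h2 π), Finset.sum_add_distrib, Finset.sum_const,
    Finset.card_univ, Fintype.card_perm, Fintype.card_fin, smul_eq_mul, ← h1, Finset.sum_comm]
  simp only [Finset.card_filter]

/-- Under a uniformly random bijection from positions to elements, the element in position `t` is
not spanned by the elements in the positions `D` with probability at least `1 - #D / r`. -/
lemma UniformlyDense.le_card_perm_notMem_spanIdx {M : Matroid α} (e : Fin n ≃ M.E) {r : ℕ}
    (hr : M.eRank = (r : ℕ∞)) (hM : UniformlyDense M) {D : Finset (Fin n)} (hD : D.card ≤ r)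
    {t : Fin n} (ht : t ∉ D) :
    ((r : ℝ) - D.card) * n.factorial ≤
      r * (Finset.univ.filter fun π : Equiv.Perm (Fin n) =>
        π t ∉ spanIdx M e (D.map π.toEmbedding)).card := by
  set X := (Finset.univ.filter fun π : Equiv.Perm (Fin n) =>
        π t ∈ spanIdx M e (D.map π.toEmbedding)).card with hX
  have h1 : X + (Finset.univ.filter fun π : Equiv.Perm (Fin n) =>
      π t ∉ spanIdx M e (D.map π.toEmbedding)).card = n.factorial := by
    rw [hX, Finset.card_filter_add_card_filter_not, Finset.card_univ, Fintype.card_perm,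
      Fintype.card_fin]
  have h2 := card_mul_card_perm_mem_spanIdx M e D ht
  rw [← hX] at h2
  have h3 : r * (Dᶜ.card * X + n.factorial * D.card) ≤ n.factorial * (n * D.card) := by
    rw [h2, Finset.mul_sum]
    refine (Finset.sum_le_card_nsmul _ _ (n * D.card) ?_).trans_eq ?_
    · intro π _
      simpa using hM.mul_card_spanIdx_le e hr (D.map π.toEmbedding)
    · rw [Finset.card_univ, Fintype.card_perm, Fintype.card_fin, smul_eq_mul]
  have hc : Dᶜ.card + D.card = n := by rw [Finset.card_compl_add_card, Fintype.card_fin]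
  have hpos : 0 < Dᶜ.card := Finset.card_pos.2 ⟨t, Finset.mem_compl.2 ht⟩
  have h4 : (r * X : ℝ) ≤ n.factorial * D.card := by
    have hpos' : (0 : ℝ) < Dᶜ.card := by exact_mod_cast hpos
    have h3' : (r : ℝ) * (Dᶜ.card * X + n.factorial * D.card) ≤ n.factorial * (n * D.card) := by
      exact_mod_cast h3
    have hc' : (n : ℝ) = Dᶜ.card + D.card := by exact_mod_cast hc.symm
    have hD' : (D.card : ℝ) ≤ r := by exact_mod_cast hD
    have h5 : (0 : ℝ) ≤ n.factorial * D.card := by positivity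
    have h6 := mul_le_mul_of_nonneg_left hD' h5
    rw [hc'] at h3'
    refine le_of_mul_le_mul_left ?_ hpos'
    linarith
  have h1' : (X : ℝ) + (Finset.univ.filter fun π : Equiv.Perm (Fin n) =>
      π t ∉ spanIdx M e (D.map π.toEmbedding)).card = n.factorial := by exact_mod_cast h1
  rw [sub_mul, ← h1', mul_add]
  rw [← h1'] at h4
  linarith

end Dense

section Algorithm

variable {α : Type*} {n : ℕ}

/-! ### Runs of the algorithm -/

/-- `ρ` lists the elements from the heaviest to the lightest one. -/
def IsRanking (v : Fin n → ℝ) (τ ρ : Equiv.Perm (Fin n)) : Prop :=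
  ∀ i j, Heavier v τ i j ↔ ρ.symm i < ρ.symm j

/-- The ranking sorts by the pairs of weight and tie-breaker. Two decreasing rearrangements of the same
weights agree, so the element of rank `i` has weight `w i`, even if there are ties. -/
lemma exists_isRanking {w : Fin n → ℝ} (hw : Antitone w) (σ τ : Equiv.Perm (Fin n)) :
    ∃ ρ : Equiv.Perm (Fin n), IsRanking (elemWeight w σ) τ ρ ∧
      ∀ i, elemWeight w σ (ρ i) = w i := by
  let f : Fin n → ℝᵒᵈ ×ₗ (Fin n)ᵒᵈ := fun j =>
    toLex (OrderDual.toDual (elemWeight w σ j), OrderDual.toDual (τ j))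
  have hf : Function.Injective f := by
    intro i j h
    have h' := congrArg (fun x => OrderDual.ofDual (ofLex x).2) h
    exact τ.injective h'
  have hmono : StrictMono (f ∘ Tuple.sort f) :=
    (Tuple.monotone_sort f).strictMono_of_injective (hf.comp (Tuple.sort f).injective)
  have hlt : ∀ i j, Heavier (elemWeight w σ) τ i j ↔ f i < f j := by
    intro i j
    simp only [f, Prod.Lex.toLex_lt_toLex, OrderDual.toDual_lt_toDual, Heavier,
      OrderDual.toDual_inj, eq_comm]
  refine ⟨Tuple.sort f, ?_, ?_⟩
  · intro i j
    rw [hlt, ← hmono.lt_iff_lt]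
    simp
  · have h1 : Monotone ((fun j => OrderDual.toDual (elemWeight w σ j)) ∘ Tuple.sort f) := by
      intro i j hij
      have := hmono.monotone hij
      simp only [f, Function.comp_apply, Prod.Lex.toLex_le_toLex] at this
      rcases this with h | h
      · exact h.le
      · exact h.1.le
    have h2 : Monotone ((fun j => OrderDual.toDual (elemWeight w σ j)) ∘ σ) := by
      intro i j hij
      simp only [Function.comp_apply, elemWeight, Equiv.symm_apply_apply, OrderDual.toDual_le_toDual]
      exact hw hij
    intro i
    have := congrFun (Tuple.unique_monotone h1 h2) i
    simpa [elemWeight] using congrArg OrderDual.ofDual this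

/-- Renaming the elements renames the ranking. -/
lemma IsRanking.mul {w : Fin n → ℝ} {σ τ ρ : Equiv.Perm (Fin n)}
    (h : IsRanking (elemWeight w σ) τ ρ) (g : Equiv.Perm (Fin n)) :
    IsRanking (elemWeight w (g * σ)) (τ * g⁻¹) (g * ρ) := by
  intro i j
  exact h (g⁻¹ i) (g⁻¹ j)

lemma mem_topSet_iff {r : ℕ} {v : Fin n → ℝ} {τ ρ : Equiv.Perm (Fin n)} (hρ : IsRanking v τ ρ)
    (π : Equiv.Perm (Fin n)) (k : ℕ) (j : Fin n) :
    π j ∈ topSet r v τ π k ↔ j ∈ topTimes r (ρ⁻¹ * π) k := by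
  classical
  rw [topSet, Finset.mem_filter, mem_topTimes]
  have h1 : ∀ l, l ∈ seen π k ↔ (π.symm l).val < k := by simp [seen]
  rw [h1, Equiv.symm_apply_apply]
  refine and_congr_right fun _ => ?_
  have : ((seen π k).filter fun i => Heavier v τ i (π j)).card =
      (Finset.univ.filter fun l : Fin n => l.val < k ∧ (ρ⁻¹ * π) l < (ρ⁻¹ * π) j).card := by
    refine Finset.card_equiv π.symm ?_
    intro l
    rw [Finset.mem_filter, Finset.mem_filter, h1, hρ]
    simp [Equiv.Perm.mul_apply, Equiv.Perm.inv_def]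
  rw [← this]

lemma candidate_iff {r m : ℕ} {v : Fin n → ℝ} {τ ρ : Equiv.Perm (Fin n)} (hρ : IsRanking v τ ρ)
    (π : Equiv.Perm (Fin n)) (t : Fin n) :
    (m ≤ t.val ∧ π t ∈ topSet r v τ π (t.val + 1) ∧
        topSet r v τ π t.val \ topSet r v τ π (t.val + 1) ⊆ seen π m) ↔
      IsCandidate r m (ρ⁻¹ * π) t := by
  have hs : topSet r v τ π t.val \ topSet r v τ π (t.val + 1) ⊆ seen π m ↔
      ∀ l ∈ topTimes r (ρ⁻¹ * π) t.val, l ∉ topTimes r (ρ⁻¹ * π) (t.val + 1) → l.val < m := by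
    constructor
    · intro h l h1 h2
      have := h (Finset.mem_sdiff.2 ⟨(mem_topSet_iff hρ π _ l).2 h1,
        fun h3 => h2 ((mem_topSet_iff hρ π _ l).1 h3)⟩)
      simpa [seen] using this
    · intro h x hx
      obtain ⟨l, rfl⟩ := π.surjective x
      rw [Finset.mem_sdiff, mem_topSet_iff hρ, mem_topSet_iff hρ] at hx
      simpa [seen] using h l hx.1 hx.2
  rw [hs, mem_topSet_iff hρ, IsCandidate]

open scoped Classical in
lemma topReplaceAlg_succ (M : Matroid α) (e : Fin n ≃ M.E) {r : ℕ} {v : Fin n → ℝ}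
    {τ ρ : Equiv.Perm (Fin n)} (hρ : IsRanking v τ ρ) (m : ℕ) (π : Equiv.Perm (Fin n))
    (t : Fin n) :
    topReplaceAlg M e r (τ, m) v π (t.val + 1) =
      if IsCandidate r m (ρ⁻¹ * π) t ∧
          IndepIdx M e (insert (π t) (topReplaceAlg M e r (τ, m) v π t.val)) then
        insert (π t) (topReplaceAlg M e r (τ, m) v π t.val)
      else topReplaceAlg M e r (τ, m) v π t.val := by
  rw [topReplaceAlg, dif_pos t.isLt]
  refine if_congr ?_ rfl rfl
  rw [← candidate_iff hρ, and_assoc, and_assoc]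

lemma indepIdx_topReplaceAlg (M : Matroid α) (e : Fin n ≃ M.E) (r : ℕ)
    (s : Equiv.Perm (Fin n) × ℕ) (v : Fin n → ℝ) (π : Equiv.Perm (Fin n)) (k : ℕ) :
    IndepIdx M e (topReplaceAlg M e r s v π k) := by
  induction k with
  | zero => simp [topReplaceAlg, IndepIdx]
  | succ k ih =>
    rw [topReplaceAlg]
    split_ifs with h1 h2
    · exact h2.2.2.2
    · exact ih
    · exact ih

lemma topReplaceAlg_mono (M : Matroid α) (e : Fin n ≃ M.E) (r : ℕ)
    (s : Equiv.Perm (Fin n) × ℕ) (v : Fin n → ℝ) (π : Equiv.Perm (Fin n)) :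
    Monotone (topReplaceAlg M e r s v π) := by
  refine monotone_nat_of_le_succ fun k => ?_
  rw [topReplaceAlg]
  split_ifs
  · exact Finset.subset_insert _ _
  · exact le_rfl
  · exact le_rfl

lemma topReplaceAlg_subset (M : Matroid α) (e : Fin n ≃ M.E) {r : ℕ} {v : Fin n → ℝ}
    {τ ρ : Equiv.Perm (Fin n)} (hρ : IsRanking v τ ρ) (m : ℕ) (π : Equiv.Perm (Fin n)) {k : ℕ}
    (hk : k ≤ n) :
    topReplaceAlg M e r (τ, m) v π k ⊆ (candidates r m (ρ⁻¹ * π) k).map π.toEmbedding := by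
  classical
  induction k with
  | zero => simp [topReplaceAlg]
  | succ k ih =>
    have ih := ih (by omega)
    obtain ⟨t, rfl⟩ : ∃ t : Fin n, t.val = k := ⟨⟨k, hk⟩, rfl⟩
    rw [topReplaceAlg_succ M e hρ, candidates_succ]
    split_ifs with h1 h2 h2
    · rw [Finset.map_insert]
      exact Finset.insert_subset_insert _ ih
    · exact absurd h1.1 h2
    · rw [Finset.map_insert]
      exact ih.trans (Finset.subset_insert _ _)
    · exact ih

/-- A candidate is accepted if it is not spanned by the previous candidates. -/
lemma mem_topReplaceAlg (M : Matroid α) (e : Fin n ≃ M.E) {r : ℕ} {v : Fin n → ℝ}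
    {τ ρ : Equiv.Perm (Fin n)} (hρ : IsRanking v τ ρ) {m : ℕ} {π : Equiv.Perm (Fin n)} {t : Fin n}
    (hc : IsCandidate r m (ρ⁻¹ * π) t)
    (ht : π t ∉ spanIdx M e ((candidates r m (ρ⁻¹ * π) t.val).map π.toEmbedding)) :
    π t ∈ topReplaceAlg M e r (τ, m) v π n := by
  classical
  apply topReplaceAlg_mono M e r (τ, m) v π (Nat.succ_le_of_lt t.isLt)
  have hI := indepIdx_topReplaceAlg M e r (τ, m) v π t.val
  have hsub := topReplaceAlg_subset M e (r := r) hρ m π t.isLt.le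
  have hindep : IndepIdx M e (insert (π t) (topReplaceAlg M e r (τ, m) v π t.val)) := by
    have h1 : (e (π t) : α) ∉ M.closure (elems M e (topReplaceAlg M e r (τ, m) v π t.val)) := by
      intro h
      refine ht (mem_spanIdx.2 (M.closure_subset_closure ?_ h))
      exact Set.image_mono (Finset.coe_subset.2 hsub)
    have h2 := ((Matroid.Indep.notMem_closure_iff (M := M) hI (e (π t)).2).1 h1).1
    rw [IndepIdx, Finset.coe_insert, Set.image_insert_eq]
    exact h2
  rw [Nat.succ_eq_add_one, topReplaceAlg_succ M e hρ, if_pos ⟨hc, hindep⟩]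
  exact Finset.mem_insert_self _ _

/-- The algorithm is online: ranks and times enter only through comparisons between elements that
have already arrived. -/
lemma isOnline_topReplaceAlg (M : Matroid α) (e : Fin n ≃ M.E) (r : ℕ) :
    IsOnline (topReplaceAlg M e r) where
  start _ _ _ := rfl
  step s v π k := by
    rw [topReplaceAlg, dif_pos k.isLt]
    split_ifs
    · exact Or.inr rfl
    · exact Or.inl rfl
  nonanticipating := by
    classical
    intro s v v' π π' k hk hπ hv
    have hseen : ∀ a ≤ k, seen π a = seen π' a := by
      intro a ha
      ext j
      simp only [seen, Finset.mem_filter, Finset.mem_univ, true_and]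
      constructor
      · intro h
        have := hπ _ (lt_of_lt_of_le h ha)
        rw [Equiv.apply_symm_apply] at this
        rw [this, Equiv.symm_apply_apply]
        exact h
      · intro h
        have := hπ (π'.symm j) (lt_of_lt_of_le h ha)
        rw [Equiv.apply_symm_apply] at this
        rw [← this, Equiv.symm_apply_apply]
        exact h
    have hheavy : ∀ i ∈ seen π k, ∀ j ∈ seen π k,
        (Heavier v s.1 i j ↔ Heavier v' s.1 i j) := by
      intro i hi j hj
      simp only [seen, Finset.mem_filter, Finset.mem_univ, true_and] at hi hj
      have h1 := hv _ _ hi hj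
      have h2 := hv _ _ hj hi
      simp only [Equiv.apply_symm_apply] at h1 h2
      simp only [Heavier, ← not_le, le_antisymm_iff, h1, h2]
    have htop : ∀ a ≤ k, topSet r v s.1 π a = topSet r v' s.1 π' a := by
      intro a ha
      have hsub : ∀ i ∈ seen π a, i ∈ seen π k := by
        intro i
        simp only [seen, Finset.mem_filter, Finset.mem_univ, true_and]
        omega
      rw [topSet, topSet, ← hseen a ha]
      refine Finset.filter_congr fun j hj => ?_
      rw [Finset.filter_congr fun i hi => hheavy i (hsub i hi) j (hsub j hj)]
    have main : ∀ a ≤ k, topReplaceAlg M e r s v π a = topReplaceAlg M e r s v' π' a := by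
      intro a ha
      induction a with
      | zero => rfl
      | succ a ih =>
        have ih := ih (by omega)
        have hπa := hπ ⟨a, by omega⟩ (by simpa using ha)
        rw [topReplaceAlg, topReplaceAlg, ih, htop _ ha, htop a (by omega)]
        split_ifs with h1 h2 h3 h3
        · rw [hπa]
        · exact absurd (by rw [← hseen s.2 (by omega), ← hπa]; exact h2) h3
        · exact absurd (by rw [hseen s.2 (by omega), hπa]; exact h3) h2
        · rfl
        · rfl
    exact main k le_rfl

end Algorithm

section Expectation

variable {α : Type*} {n : ℕ}

/-! ### The expected weight of the output -/

lemma expect_uniformOfFintype {Ω : Type*} [Fintype Ω] [Nonempty Ω] (f : Ω → ℝ) :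
    expect (PMF.uniformOfFintype Ω) f = (∑ ω, f ω) / Fintype.card Ω := by
  rw [expect, tsum_fintype, Finset.sum_div]
  refine Finset.sum_congr rfl fun ω _ => ?_
  rw [PMF.uniformOfFintype_apply, ENNReal.toReal_inv, ENNReal.toReal_natCast]
  ring

lemma seedLaw_apply_toReal (p : unitInterval) (τ : Equiv.Perm (Fin n)) (m : ℕ) :
    (seedLaw n p (τ, m)).toReal =
      (n.choose m * (p : ℝ) ^ m * (1 - p) ^ (n - m)) / n.factorial := by
  classical
  have h1 : ∀ τ' : Equiv.Perm (Fin n), ((ProbabilityTheory.binomial n p).toPMF.map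
      fun m => (τ', m)) (τ, m) = if τ' = τ then ProbabilityTheory.binomial n p {m} else 0 := by
    intro τ'
    rw [PMF.map_apply]
    split_ifs with h
    · subst h
      rw [tsum_eq_single m]
      · simp [MeasureTheory.Measure.toPMF_apply]
      · intro m' hm'
        simp [hm'.symm]
    · rw [ENNReal.tsum_eq_zero]
      intro m'
      rw [if_neg]
      intro h'
      exact h (congrArg Prod.fst h').symm
  rw [seedLaw, PMF.bind_apply]
  simp only [h1]
  rw [tsum_eq_single τ (by intro τ' h; simp [h]), if_pos rfl, PMF.uniformOfFintype_apply,
    ENNReal.toReal_mul, ENNReal.toReal_inv, ENNReal.toReal_natCast, Fintype.card_perm,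
    Fintype.card_fin, ← MeasureTheory.measureReal_def, ProbabilityTheory.binomial_real_singleton]
  ring

lemma expect_seedLaw (p : unitInterval) (f : Equiv.Perm (Fin n) × ℕ → ℝ) :
    expect (seedLaw n p) f = ∑ m ∈ Finset.range (n + 1),
      (n.choose m * (p : ℝ) ^ m * (1 - p) ^ (n - m)) * ((∑ τ, f (τ, m)) / n.factorial) := by
  rw [expect, tsum_eq_sum (s := Finset.univ ×ˢ Finset.range (n + 1)), Finset.sum_product_right]
  · refine Finset.sum_congr rfl fun m _ => ?_
    rw [Finset.sum_div, Finset.mul_sum]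
    refine Finset.sum_congr rfl fun τ _ => ?_
    rw [seedLaw_apply_toReal]
    ring
  · rintro ⟨τ, m⟩ h
    have hm : n < m := by simpa using h
    rw [seedLaw_apply_toReal, Nat.choose_eq_zero_of_lt hm]
    simp

open scoped Classical in
/-- The indicator of the event that the element of rank `i` is a candidate and not spanned by the
previous candidates, if `ρ` lists the elements by decreasing weight and `π` by time of arrival. -/
noncomputable def acceptIndicator (M : Matroid α) (e : Fin n ≃ M.E) (r m : ℕ) (i : Fin n)
    (ρ π : Equiv.Perm (Fin n)) : ℝ :=
  if IsCandidate r m (ρ⁻¹ * π) (π⁻¹ (ρ i)) ∧ ρ i ∉ spanIdx M e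
    ((candidates r m (ρ⁻¹ * π) (π⁻¹ (ρ i)).val).map π.toEmbedding) then 1 else 0

/-- Each of the `r` heaviest elements is accepted with probability at least the average of
`pairProb k m` over the times `k`. -/
lemma le_sum_acceptIndicator {M : Matroid α} (e : Fin n ≃ M.E) {r m : ℕ}
    (hr : M.eRank = (r : ℕ∞)) (hM : UniformlyDense M) {i : Fin n} (hi : i.val < r) :
    ((∑ k ∈ Finset.Ico m n, pairProb k m) / n) * (n.factorial * n.factorial) ≤
      ∑ ρ : Equiv.Perm (Fin n), ∑ π : Equiv.Perm (Fin n), acceptIndicator M e r m i ρ π := by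
  classical
  -- the relative order `μ` of the arrivals and their identities `π` are independent
  have h1 : ∑ ρ : Equiv.Perm (Fin n), ∑ π : Equiv.Perm (Fin n), acceptIndicator M e r m i ρ π =
      ∑ μ : Equiv.Perm (Fin n), ∑ π : Equiv.Perm (Fin n),
        if IsCandidate r m μ (μ⁻¹ i) ∧ π (μ⁻¹ i) ∉ spanIdx M e
          ((candidates r m μ (μ⁻¹ i).val).map π.toEmbedding) then 1 else 0 := by
    rw [Finset.sum_comm, Finset.sum_comm (γ := Equiv.Perm (Fin n))
      (f := fun (μ π : Equiv.Perm (Fin n)) => if IsCandidate r m μ (μ⁻¹ i) ∧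
        π (μ⁻¹ i) ∉ spanIdx M e ((candidates r m μ (μ⁻¹ i).val).map π.toEmbedding)
        then (1 : ℝ) else 0)]
    refine Finset.sum_congr rfl fun π _ => ?_
    refine Fintype.sum_equiv ((Equiv.inv _).trans (Equiv.mulRight π)) _ _ fun ρ => ?_
    have h2 : (ρ⁻¹ * π)⁻¹ i = π⁻¹ (ρ i) := by simp
    have h3 : π ((ρ⁻¹ * π)⁻¹ i) = ρ i := by simp
    simp only [Equiv.trans_apply, Equiv.inv_apply, Equiv.coe_mulRight, h3]
    rw [h2, acceptIndicator]
  have hr0 : (0 : ℝ) < r := by exact_mod_cast lt_of_le_of_lt (Nat.zero_le _) hi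
  have h4 : ∀ μ : Equiv.Perm (Fin n), n.factorial * candidateGain r m (μ.symm i) μ ≤
      r * ∑ π : Equiv.Perm (Fin n),
        if IsCandidate r m μ (μ⁻¹ i) ∧ π (μ⁻¹ i) ∉ spanIdx M e
          ((candidates r m μ (μ⁻¹ i).val).map π.toEmbedding) then 1 else 0 := by
    intro μ
    rw [candidateGain, ← Equiv.Perm.inv_def]
    split_ifs with hc
    · simp only [hc, true_and]
      rw [Finset.sum_boole, mul_comm]
      exact hM.le_card_perm_notMem_spanIdx e hr
        (card_candidates_le r m μ (μ⁻¹ i).isLt.le) (by simp [candidates])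
    · rw [mul_zero]
      positivity
  have h5 := Finset.sum_le_sum fun μ (_ : μ ∈ Finset.univ) => h4 μ
  rw [← Finset.mul_sum, ← Finset.mul_sum, ← h1] at h5
  have h6 := le_sum_candidateGain_symm (m := m) i hi
  have h7 := mul_le_mul_of_nonneg_left h6 (Nat.cast_nonneg (α := ℝ) n.factorial)
  refine le_of_mul_le_mul_left ?_ hr0
  linarith

/-- For a fixed ranking, the weight of the output is bounded below by accepted elements among the
`r` heaviest ones. -/
lemma sum_acceptIndicator_le_setWeight (M : Matroid α) (e : Fin n ≃ M.E) {r m : ℕ}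
    {v w : Fin n → ℝ} {τ ρ : Equiv.Perm (Fin n)} (hρ : IsRanking v τ ρ)
    (hv : ∀ i, v (ρ i) = w i) (hw : ∀ i, 0 ≤ w i) (π : Equiv.Perm (Fin n)) :
    ∑ i ∈ Finset.univ.filter (fun i : Fin n => i.val < r), w i * acceptIndicator M e r m i ρ π ≤
      setWeight v (topReplaceAlg M e r (τ, m) v π n) := by
  classical
  have h1 : setWeight v (topReplaceAlg M e r (τ, m) v π n) =
      ∑ i, w i * if ρ i ∈ topReplaceAlg M e r (τ, m) v π n then 1 else 0 := by
    simp only [mul_ite, mul_one, mul_zero, ← hv]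
    rw [Equiv.sum_comp ρ fun j => if j ∈ topReplaceAlg M e r (τ, m) v π n then v j else 0,
      Finset.sum_ite_mem, Finset.univ_inter, setWeight]
  rw [h1]
  refine (Finset.sum_le_sum_of_subset_of_nonneg (Finset.filter_subset _ _) ?_).trans
    (Finset.sum_le_sum fun i _ => mul_le_mul_of_nonneg_left ?_ (hw i))
  · intro i _ _
    refine mul_nonneg (hw i) ?_
    rw [acceptIndicator]
    split_ifs <;> norm_num
  · rw [acceptIndicator]
    split_ifs with h2 h3 h3
    · exact le_rfl
    · refine absurd ?_ h3
      have := mem_topReplaceAlg M e hρ h2.1 (by simpa using h2.2)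
      simpa using this
    · exact zero_le_one
    · exact le_rfl

lemma topWeight_nonneg {w : Fin n → ℝ} (hw : ∀ i, 0 ≤ w i) (r : ℕ) : 0 ≤ topWeight w r :=
  Finset.sum_nonneg fun i _ => hw i

/-- For a fixed sample size, the sum of the weight of the output over all assignments, arrival
orders and tie-breaking rules. -/
lemma le_sum_setWeight {M : Matroid α} (e : Fin n ≃ M.E) {r : ℕ}
    (hr : M.eRank = (r : ℕ∞)) (hM : UniformlyDense M) {w : Fin n → ℝ} (hw : Antitone w)
    (hw0 : ∀ i, 0 ≤ w i) (m : ℕ) :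
    ((∑ k ∈ Finset.Ico m n, pairProb k m) / n) * topWeight w r * (n.factorial : ℝ) ^ 3 ≤
      ∑ σ : Equiv.Perm (Fin n), ∑ π : Equiv.Perm (Fin n), ∑ τ : Equiv.Perm (Fin n),
        setWeight (elemWeight w σ) (topReplaceAlg M e r (τ, m) (elemWeight w σ) π n) := by
  set Φ : Equiv.Perm (Fin n) → Equiv.Perm (Fin n) → Equiv.Perm (Fin n) → ℝ := fun σ τ π =>
    setWeight (elemWeight w σ) (topReplaceAlg M e r (τ, m) (elemWeight w σ) π n)
  have hN : (0 : ℝ) < n.factorial := by exact_mod_cast Nat.factorial_pos _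
  -- renaming the elements by a uniformly random `g` makes the ranking uniformly random
  have h1 : ∑ σ, ∑ τ, ∑ g : Equiv.Perm (Fin n), ∑ π, Φ (g * σ) (τ * g⁻¹) π =
      n.factorial * ∑ σ, ∑ π, ∑ τ, Φ σ τ π := by
    have h2 : ∀ g ∈ (Finset.univ : Finset (Equiv.Perm (Fin n))),
        ∑ σ, ∑ τ, ∑ π, Φ (g * σ) (τ * g⁻¹) π = ∑ σ, ∑ π, ∑ τ, Φ σ τ π := by
      intro g _
      rw [← Equiv.sum_comp (Equiv.mulLeft g) fun σ => ∑ π, ∑ τ, Φ σ τ π]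
      refine Finset.sum_congr rfl fun σ _ => ?_
      rw [Finset.sum_comm (γ := Equiv.Perm (Fin n)) (f := fun π τ => Φ (Equiv.mulLeft g σ) τ π),
        ← Equiv.sum_comp (Equiv.mulRight g⁻¹) fun τ => ∑ π, Φ (Equiv.mulLeft g σ) τ π]
      rfl
    have h3 := Finset.sum_congr rfl h2
    rw [Finset.sum_const, nsmul_eq_mul, Finset.card_univ, Fintype.card_perm, Fintype.card_fin] at h3
    rw [← h3, Finset.sum_comm]
    rw [Finset.sum_comm (γ := Equiv.Perm (Fin n))
      (f := fun g σ => ∑ τ, ∑ π, Φ (g * σ) (τ * g⁻¹) π)]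
    rw [Finset.sum_comm]
    refine Finset.sum_congr rfl fun σ _ => ?_
    rw [Finset.sum_comm]
  have h4 : ∀ σ τ, ((∑ k ∈ Finset.Ico m n, pairProb k m) / n) * topWeight w r *
      (n.factorial * n.factorial) ≤ ∑ g : Equiv.Perm (Fin n), ∑ π, Φ (g * σ) (τ * g⁻¹) π := by
    intro σ τ
    obtain ⟨ρ, hρ, hv⟩ := exists_isRanking hw σ τ
    calc _ = ∑ i ∈ Finset.univ.filter (fun i : Fin n => i.val < r),
          w i * (((∑ k ∈ Finset.Ico m n, pairProb k m) / n) * (n.factorial * n.factorial)) := by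
          rw [← Finset.sum_mul, topWeight]
          ring
      _ ≤ ∑ i ∈ Finset.univ.filter (fun i : Fin n => i.val < r),
          w i * ∑ ρ : Equiv.Perm (Fin n), ∑ π, acceptIndicator M e r m i ρ π := by
          refine Finset.sum_le_sum fun i hi => mul_le_mul_of_nonneg_left ?_ (hw0 i)
          exact le_sum_acceptIndicator e hr hM (Finset.mem_filter.1 hi).2
      _ = ∑ g : Equiv.Perm (Fin n), ∑ π,
          ∑ i ∈ Finset.univ.filter (fun i : Fin n => i.val < r),
            w i * acceptIndicator M e r m i (g * ρ) π := by
          simp only [Finset.mul_sum]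
          rw [Finset.sum_comm, ← Equiv.sum_comp (Equiv.mulRight ρ)]
          refine Finset.sum_congr rfl fun g _ => ?_
          rw [Finset.sum_comm]
          rfl
      _ ≤ _ := by
          refine Finset.sum_le_sum fun g _ => Finset.sum_le_sum fun π _ => ?_
          refine sum_acceptIndicator_le_setWeight M e (hρ.mul g) ?_ hw0 π
          intro i
          rw [← hv i]
          change w (σ.symm (g.symm (g (ρ i)))) = w (σ.symm (ρ i))
          rw [Equiv.symm_apply_apply]
  have h5 := Finset.sum_le_sum fun σ (_ : σ ∈ Finset.univ) =>
    Finset.sum_le_sum fun τ (_ : τ ∈ Finset.univ) => h4 σ τ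
  rw [h1] at h5
  simp only [Finset.sum_const, nsmul_eq_mul, Finset.card_univ, Fintype.card_perm,
    Fintype.card_fin] at h5
  refine le_of_mul_le_mul_left ?_ hN
  linarith

lemma expectedALG_seedLaw (p : unitInterval)
    (A : Equiv.Perm (Fin n) × ℕ → (Fin n → ℝ) → Equiv.Perm (Fin n) → ℕ → Finset (Fin n))
    (w : Fin n → ℝ) :
    expectedALG (seedLaw n p) A w = ∑ m ∈ Finset.range (n + 1),
      (n.choose m * (p : ℝ) ^ m * (1 - p) ^ (n - m)) *
        ((∑ σ, ∑ π, ∑ τ, setWeight (elemWeight w σ) (A (τ, m) (elemWeight w σ) π n)) /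
          (n.factorial : ℝ) ^ 3) := by
  simp only [expectedALG, expect_uniformOfFintype, expect_seedLaw, Fintype.card_perm,
    Fintype.card_fin, Finset.sum_div, Finset.mul_sum]
  symm
  rw [Finset.sum_comm]
  refine Finset.sum_congr rfl fun σ _ => ?_
  rw [Finset.sum_comm]
  refine Finset.sum_congr rfl fun π _ => ?_
  refine Finset.sum_congr rfl fun m _ => Finset.sum_congr rfl fun τ _ => ?_
  field_simp

lemma neg_sq_mul_log_mul_topWeight_le {M : Matroid α} (e : Fin n ≃ M.E) {r : ℕ}
    (hr : M.eRank = (r : ℕ∞)) (hM : UniformlyDense M) {p : unitInterval} (hp : 0 < (p : ℝ))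
    {w : Fin n → ℝ} (hw : Antitone w) (hw0 : ∀ i, 0 ≤ w i) :
    (-((p : ℝ) ^ 2 * Real.log (p : ℝ))) * topWeight w r ≤
      expectedALG (seedLaw n p) (topReplaceAlg M e r) w := by
  have hp' : (0 : ℝ) ≤ 1 - p := by linarith [p.2.2]
  have hN : (0 : ℝ) < n.factorial := by exact_mod_cast Nat.factorial_pos _
  rw [expectedALG_seedLaw]
  rcases Nat.eq_zero_or_pos n with rfl | hn
  · simp [topWeight, setWeight, topReplaceAlg]
  calc _ ≤ p * (1 - p) * topWeight w r :=
        mul_le_mul_of_nonneg_right (neg_sq_mul_log_le hp) (topWeight_nonneg hw0 r)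
    _ ≤ (∑ m ∈ Finset.range (n + 1), (n.choose m * (p : ℝ) ^ m * (1 - p) ^ (n - m)) *
          ((∑ k ∈ Finset.Ico m n, pairProb k m) / n)) * topWeight w r :=
        mul_le_mul_of_nonneg_right (mul_one_sub_le_sum_binomial hn hp.le p.2.2)
          (topWeight_nonneg hw0 r)
    _ ≤ _ := by
        rw [Finset.sum_mul]
        refine Finset.sum_le_sum fun m _ => ?_
        rw [mul_assoc]
        refine mul_le_mul_of_nonneg_left ?_ (by positivity)
        rw [le_div_iff₀ (by positivity)]
        exact le_sum_setWeight e hr hM hw hw0 m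

/-! ### The optimum -/

lemma indepIdx_greedy (M : Matroid α) (e : Fin n ≃ M.E) (σ : Equiv.Perm (Fin n)) (k : ℕ) :
    IndepIdx M e (greedy M e σ k) := by
  induction k with
  | zero => simp [greedy, IndepIdx]
  | succ k ih =>
    rw [greedy]
    split_ifs with h1 h2
    · exact h2
    · exact ih
    · exact ih

lemma IndepIdx.card_le {M : Matroid α} {e : Fin n ≃ M.E} {r : ℕ} (hr : M.eRank = (r : ℕ∞))
    {S : Finset (Fin n)} (hS : IndepIdx M e S) : S.card ≤ r := by
  have h := Matroid.Indep.encard_le_eRank hS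
  have h' := encard_elems M e S
  rw [elems] at h'
  rw [h', hr] at h
  exact_mod_cast h

/-- The sum of at most `r` terms of a nonnegative decreasing list is at most that of the first
`r` terms. -/
lemma sum_le_topWeight {w : Fin n → ℝ} (hw : Antitone w) (hw0 : ∀ i, 0 ≤ w i) {r : ℕ}
    {S : Finset (Fin n)} (hS : S.card ≤ r) : ∑ i ∈ S, w i ≤ topWeight w r := by
  set T := Finset.univ.filter fun i : Fin n => i.val < r with hT
  rw [topWeight, ← hT]
  rcases Nat.lt_or_ge r n with hrn | hrn
  · have hcard : T.card = r := by rw [hT, Fin.card_filter_val_lt, min_eq_right hrn.le]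
    -- the weight `c` at rank `r` separates the terms inside and outside `T`
    set c := w ⟨r, hrn⟩
    have h1 : ∑ i ∈ S \ T, w i ≤ (S \ T).card * c := by
      rw [← nsmul_eq_mul]
      refine Finset.sum_le_card_nsmul _ _ _ fun i hi => hw ?_
      have := (Finset.mem_sdiff.1 hi).2
      simpa [hT, Fin.le_def] using this
    have h2 : (T \ S).card * c ≤ ∑ i ∈ T \ S, w i := by
      rw [← nsmul_eq_mul]
      refine Finset.card_nsmul_le_sum _ _ _ fun i hi => hw ?_
      have := (Finset.mem_sdiff.1 hi).1
      rw [hT, Finset.mem_filter] at this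
      exact this.2.le
    have h3 : ((S \ T).card : ℝ) ≤ (T \ S).card := by
      have := Finset.card_sdiff_le_card_sdiff_iff.2 (hS.trans_eq hcard.symm)
      exact_mod_cast this
    have h4 := mul_le_mul_of_nonneg_right h3 (hw0 ⟨r, hrn⟩)
    have h5 := Finset.sum_sdiff (f := w) (Finset.inter_subset_left : S ∩ T ⊆ S)
    have h6 := Finset.sum_sdiff (f := w) (Finset.inter_subset_right : S ∩ T ⊆ T)
    rw [Finset.sdiff_inter_self_left] at h5
    rw [Finset.sdiff_inter_self_right] at h6
    linarith
  · refine Finset.sum_le_sum_of_subset_of_nonneg ?_ fun i _ _ => hw0 i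
    intro i _
    simp only [hT, Finset.mem_filter, Finset.mem_univ, true_and]
    omega

lemma expectedOPT_le_topWeight {M : Matroid α} (e : Fin n ≃ M.E) {r : ℕ}
    (hr : M.eRank = (r : ℕ∞)) {w : Fin n → ℝ} (hw : Antitone w) (hw0 : ∀ i, 0 ≤ w i) :
    expectedOPT M e w ≤ topWeight w r := by
  have hN : (0 : ℝ) < n.factorial := by exact_mod_cast Nat.factorial_pos _
  rw [expectedOPT, expect_uniformOfFintype, Fintype.card_perm, Fintype.card_fin, div_le_iff₀ hN]
  have h : ∀ σ ∈ (Finset.univ : Finset (Equiv.Perm (Fin n))),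
      setWeight (elemWeight w σ) (OPT M e σ) ≤ topWeight w r := by
    intro σ _
    have h1 : setWeight (elemWeight w σ) (OPT M e σ) =
        ∑ i ∈ (OPT M e σ).map σ.symm.toEmbedding, w i := by
      rw [Finset.sum_map]
      rfl
    rw [h1]
    refine sum_le_topWeight hw hw0 ?_
    rw [Finset.card_map]
    exact (indepIdx_greedy M e σ n).card_le hr
  refine (Finset.sum_le_card_nsmul _ _ _ h).trans_eq ?_
  rw [nsmul_eq_mul, Finset.card_univ, Fintype.card_perm, Fintype.card_fin, mul_comm]

end Expectation

theorem theorem3p2 {α : Type*} {n : ℕ} (M : Matroid α) (e : Fin n ≃ M.E) (r : ℕ)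
    (hr : M.eRank = (r : ℕ∞)) (hM : UniformlyDense M) :
    (∀ p : unitInterval, 0 < (p : ℝ) →
      ∀ w : Fin n → ℝ, Antitone w → (∀ i, 0 ≤ w i) →
        (-((p : ℝ) ^ 2 * Real.log (p : ℝ))) * topWeight w r ≤
            expectedALG (seedLaw n p) (topReplaceAlg M e r) w ∧
        (-((p : ℝ) ^ 2 * Real.log (p : ℝ))) * expectedOPT M e w ≤
            (-((p : ℝ) ^ 2 * Real.log (p : ℝ))) * topWeight w r) ∧
    IsCompetitive M e (seedLaw n halfProb) (topReplaceAlg M e r) (2 * Real.exp 1) := by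
  refine ⟨fun p hp w hw hw0 => ⟨neg_sq_mul_log_mul_topWeight_le e hr hM hp hw hw0, ?_⟩, ?_⟩
  · refine mul_le_mul_of_nonneg_left (expectedOPT_le_topWeight e hr hw hw0) ?_
    have := Real.log_nonpos p.2.1 p.2.2
    nlinarith [sq_nonneg (p : ℝ)]
  · refine ⟨isOnline_topReplaceAlg M e r, indepIdx_topReplaceAlg M e r, fun w hw hw0 => ?_⟩
    have h1 := neg_sq_mul_log_mul_topWeight_le e hr hM (p := halfProb) (Real.exp_pos _) hw hw0
    have h2 := expectedOPT_le_topWeight e hr hw hw0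
    -- for `p = e^{-1/2}` the factor `-p² log p` is `1 / (2e)`
    have h3 : -((halfProb : ℝ) ^ 2 * Real.log (halfProb : ℝ)) = (2 * Real.exp 1)⁻¹ := by
      have h4 : (halfProb : ℝ) = Real.exp (-1 / 2) := rfl
      have h5 : (-1 / 2 : ℝ) + -1 / 2 = -1 := by norm_num
      rw [h4, Real.log_exp, sq, ← Real.exp_add, h5, Real.exp_neg, mul_inv]
      ring
    rw [h3, inv_mul_le_iff₀ (by positivity)] at h1
    exact h2.trans h1
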